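/- Let $X_1,X_2,\dots$ be iid real random variables whose law has a Lebesgue density $f$. For $j\ge 0$, a locally integrable $g$ is a weak derivative of order $j$ of $f$ if $\int f\varphi^{(j)}=(-1)^j\int g\varphi$ for all $\varphi\in C_c^\infty(\mathbb R)$. Let $\ell\ge 1$ be an integer and suppose that $f\in W^{\ell,1}$, i.e. $f$ and its weak derivatives $f^{(1)},\dots,f^{(\ell)}$ exist and are in $L_1(\mathbb R)$. Let $K:\mathbb R\to\mathbb R$ be a kernel of order $\ell$: $u^jK(u)\in L_1(\mathbb R)$ for $0\le j\le \ell$, $\int K(u)\,du=1$, $\int u^jK(u)\,du=0$ for $1\le j\le \ell-1$, and $k_\ell:=\int u^\ell K(u)\,du\ne 0$. Let $F_n$ be the empirical distribution function of $X_1,\dots,X_n$ and, for $h>0$, $$\hat f_h(x)=\frac1{nh}\sum_{i=1}^nK\Big(\frac{x-X_i}{h}\Big),\qquad \hat F_n^h(x)=\int_{-\infty}^x\hat f_h(t)\,dt .$$ Let $d$ be either the Kolmogorov distance $d_\infty(F,G)=\sup_x|F(x)-G(x)|$ or, for some integer $k\ge 1$, the $k$-th order Kuiper distance $$d_{kuip,k}(F,G)=\sup_{a_1\le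 b_1\le a_2\le b_2\le\dots\le a_k\le b_k}\ \sum_{i=1}^k\big|(F(b_i)-F(a_i))-(G(b_i)-G(a_i))\big| ,$$ both also applied to arbitrary functions $\mathbb R\to\mathbb R$. Let $s(n)=cn^{-\gamma}$ with $c>0$ and $0<\gamma<1/2$. Then $f^{(\ell-1)}$ has a continuous representative (denoted by the same symbol; $f^{(0)}=f$) and $0<d(f^{(\ell-1)},0)<\infty$. Almost surely, for all sufficiently large $n$ the equation $d(F_n,\hat F_n^h)=s(n)$ has a solution $h>0$, and every sequence $(h_{s,n})_n$ such that, for all sufficiently large $n$, $h_{s,n}>0$ is a solution of this equation satisfies $$h_{s,n}=\left(\frac{c\,\ell!}{|k_\ell|\,d(f^{(\ell-1)},0)}\right)^{1/\ell}n^{-\gamma/\ell}\,(1+o(1))\qquad(n\to\infty).$$ -/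

import Mathlib

open MeasureTheory ProbabilityTheory Filter Topology Asymptotics
open scoped ENNReal

noncomputable section

/-- `g` is a weak derivative of order `j` of `f` on the real line: both functions are locally
integrable and `∫ f φ⁽ʲ⁾ = (-1)ʲ ∫ g φ` for every smooth compactly supported `φ`.
For `j = 0` this says that `g = f` almost everywhere. -/
def IsWeakDeriv (j : ℕ) (f g : ℝ → ℝ) : Prop :=
  LocallyIntegrable f volume ∧ LocallyIntegrable g volume ∧
    ∀ φ : ℝ → ℝ, ContDiff ℝ ((⊤ : ℕ∞) : WithTop ℕ∞) φ → HasCompactSupport φ →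
      ∫ x, f x * iteratedDeriv j φ x = (-1 : ℝ) ^ j * ∫ x, g x * φ x

/-- The Sobolev space `W^{ℓ,1}(ℝ)`: `f` is integrable and has integrable weak derivatives of all
orders up to `ℓ`. -/
def MemSobolevL1 (ℓ : ℕ) (f : ℝ → ℝ) : Prop :=
  Integrable f volume ∧
    ∀ j : ℕ, 1 ≤ j → j ≤ ℓ → ∃ g : ℝ → ℝ, Integrable g volume ∧ IsWeakDeriv j f g

/-- The `j`-th moment `∫ uʲ K(u) du`. -/
def kernelMoment (K : ℝ → ℝ) (j : ℕ) : ℝ := ∫ u, u ^ j * K u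

/-- `K` is a kernel of order `ℓ`. -/
structure IsKernelOfOrder (ℓ : ℕ) (K : ℝ → ℝ) : Prop where
  one_le : 1 ≤ ℓ
  integrable : ∀ j : ℕ, j ≤ ℓ → Integrable (fun u : ℝ => u ^ j * K u) volume
  moment_zero : kernelMoment K 0 = 1
  moment_mid : ∀ j : ℕ, 1 ≤ j → j < ℓ → kernelMoment K j = 0
  moment_top : kernelMoment K ℓ ≠ 0

/-- The empirical distribution function of the first `n` entries of the sample `x`. -/
def empiricalCDF (x : ℕ → ℝ) (n : ℕ) (t : ℝ) : ℝ :=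
  (1 / (n : ℝ)) * (((Finset.range n).filter (fun i => x i ≤ t)).card : ℝ)

/-- The kernel density estimator with bandwidth `h` from the first `n` entries of `x`. -/
def kernelDensityEstimator (K : ℝ → ℝ) (x : ℕ → ℝ) (n : ℕ) (h : ℝ) (t : ℝ) : ℝ :=
  (1 / ((n : ℝ) * h)) * ∑ i ∈ Finset.range n, K ((t - x i) / h)

/-- The kernel estimator of the distribution function, `t ↦ ∫_{-∞}^t` of the kernel density
estimator. -/
def kernelCDFEstimator (K : ℝ → ℝ) (x : ℕ → ℝ) (n : ℕ) (h : ℝ) (t : ℝ) : ℝ :=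
  ∫ y in Set.Iic t, kernelDensityEstimator K x n h y

/-- The Kolmogorov distance `‖F - G‖_∞`, with values in `[0, ∞]`. -/
def kolmogorovDist (F G : ℝ → ℝ) : ℝ≥0∞ :=
  ⨆ x : ℝ, ENNReal.ofReal |F x - G x|

/-- The `k`-th order Kuiper distance, with values in `[0, ∞]`; the supremum is over all
`a₁ ≤ b₁ ≤ a₂ ≤ b₂ ≤ … ≤ a_k ≤ b_k`. -/
def kuiperDist (k : ℕ) (F G : ℝ → ℝ) : ℝ≥0∞ :=
  ⨆ (a : Fin k → ℝ) (b : Fin k → ℝ)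
    (_ : (∀ i, a i ≤ b i) ∧ ∀ i j, i < j → b i ≤ a j),
    ENNReal.ofReal (∑ i, |(F (b i) - F (a i)) - (G (b i) - G (a i))|)

/-- `h` is a bandwidth chosen by the discrepancy principle with distance `d` and threshold `s`
from the first `n` entries of the sample `x`. -/
def IsDiscrepancyBandwidth (d : (ℝ → ℝ) → (ℝ → ℝ) → ℝ≥0∞) (K : ℝ → ℝ) (s : ℝ)
    (x : ℕ → ℝ) (n : ℕ) (h : ℝ) : Prop :=
  0 < h ∧ d (empiricalCDF x n) (kernelCDFEstimator K x n h) = ENNReal.ofReal s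

end

/-! Both distances come from seminorms controlled by the supremum norm, and the estimator is a
smoothed empirical distribution function: `kernelCDFEstimator` at bandwidth h is K_h * F_n. The
discrepancy is therefore D_n(h) = ‖F_n - K_h * F_n‖, while its deterministic counterpart is Δ(h) =
‖F - K_h * F‖. By linearity D_n and Δ differ by at most C (1 + ‖K‖₁) ‖F_n - F‖_∞, uniformly in h.
Hoeffding's inequality on a grid of quantiles and Borel-Cantelli make this almost surely O(n^{-β})
for any β in (γ, 1/2), hence o(s(n)) (`ae_eventually_abs_empiricalCDF_sub_le`).

Taylor's formula and the vanishing moments give Δ(h) ~ A h^ℓ as h → 0, with A = |k_ℓ| d(f^{(ℓ-1)},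
0) / ℓ! (`kernelSmooth_bias`). The intermediate value theorem then yields a solution of D_n(h) =
s(n) near (s(n)/A)^{1/ℓ}.

For arbitrary solutions, bandwidths that do not tend to 0 must be excluded: Δ is bounded below on
[ε, ∞) (`exists_le_abs_sub_kernelSmooth`). As h → ∞ the smoothed function flattens to a constant,
which F is not. At a finite h, F = K_h * F would make the Fourier transform of K_h equal to 1 near
0, against k_ℓ ≠ 0. So every solution sequence tends to 0, where Δ(h) ~ A h^ℓ can be inverted. -/

/-! ### Distances induced by seminorms -/

/-- A distance between functions on the line that is induced by a seminorm (with values in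
`[0, ∞]`) dominated by a multiple of the supremum norm, and which dominates the supremum norm
on functions vanishing at `-∞`. -/
structure IsUniformTypeDist (d : (ℝ → ℝ) → (ℝ → ℝ) → ℝ≥0∞) (C : ℝ) : Prop where
  nonneg : 0 ≤ C
  eq_sub : ∀ F G, d F G = d (F - G) 0
  add_le : ∀ u v, d (u + v) 0 ≤ d u 0 + d v 0
  smul : ∀ (a : ℝ) (u : ℝ → ℝ), d (a • u) 0 = ENNReal.ofReal |a| * d u 0
  le_of_bound : ∀ (u : ℝ → ℝ) (B : ℝ), (∀ x, |u x| ≤ B) → d u 0 ≤ ENNReal.ofReal (C * B)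
  le_of_tendsto : ∀ u : ℝ → ℝ, Tendsto u atBot (𝓝 0) → ∀ x, ENNReal.ofReal |u x| ≤ d u 0

theorem isUniformTypeDist_kolmogorovDist : IsUniformTypeDist kolmogorovDist 1 where
  nonneg := zero_le_one
  eq_sub F G := by simp [kolmogorovDist]
  add_le u v := by
    simp only [kolmogorovDist, Pi.add_apply, Pi.zero_apply, sub_zero]
    refine iSup_le fun x => ?_
    refine (ENNReal.ofReal_le_ofReal (abs_add_le (u x) (v x))).trans ?_
    rw [ENNReal.ofReal_add (abs_nonneg _) (abs_nonneg _)]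
    exact add_le_add (le_iSup (fun x => ENNReal.ofReal |u x|) x)
      (le_iSup (fun x => ENNReal.ofReal |v x|) x)
  smul a u := by
    simp only [kolmogorovDist, Pi.smul_apply, Pi.zero_apply, sub_zero, smul_eq_mul, abs_mul,
      ENNReal.ofReal_mul (abs_nonneg a), ENNReal.mul_iSup]
  le_of_bound u B h := by
    simp only [kolmogorovDist, Pi.zero_apply, sub_zero, one_mul]
    exact iSup_le fun x => ENNReal.ofReal_le_ofReal (h x)
  le_of_tendsto u _ x := by
    simp only [kolmogorovDist, Pi.zero_apply, sub_zero]
    exact le_iSup (fun x => ENNReal.ofReal |u x|) x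

/-- Each of the k increments of a function bounded by B is at most 2B, whence the constant. The
seminorm ignores additive constants, so it can dominate |u x| only when u vanishes at -∞: compare u
x with u y and let y → -∞. -/
theorem isUniformTypeDist_kuiperDist {k : ℕ} (hk : 1 ≤ k) :
    IsUniformTypeDist (kuiperDist k) (2 * k) where
  nonneg := by positivity
  eq_sub F G := by
    simp only [kuiperDist, Pi.sub_apply, Pi.zero_apply, sub_zero]
    refine iSup_congr fun a => iSup_congr fun b => iSup_congr fun _ => ?_
    congr 1
    refine Finset.sum_congr rfl fun i _ => ?_
    congr 1
    ring
  add_le u v := by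
    simp only [kuiperDist, Pi.add_apply, Pi.zero_apply, sub_zero]
    refine iSup_le fun a => iSup_le fun b => iSup_le fun hab => ?_
    have key : ∀ w : ℝ → ℝ, ENNReal.ofReal (∑ i, |w (b i) - w (a i)|) ≤
        ⨆ (a : Fin k → ℝ) (b : Fin k → ℝ)
          (_ : (∀ i, a i ≤ b i) ∧ ∀ i j, i < j → b i ≤ a j),
          ENNReal.ofReal (∑ i, |w (b i) - w (a i)|) := fun w =>
      le_iSup_of_le a (le_iSup_of_le b (le_iSup_of_le hab le_rfl))
    refine le_trans ?_ (add_le_add (key u) (key v))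
    rw [← ENNReal.ofReal_add (Finset.sum_nonneg fun _ _ => abs_nonneg _)
      (Finset.sum_nonneg fun _ _ => abs_nonneg _), ← Finset.sum_add_distrib]
    refine ENNReal.ofReal_le_ofReal (Finset.sum_le_sum fun i _ => ?_)
    rw [add_sub_add_comm]
    exact abs_add_le _ _
  smul a u := by
    simp only [kuiperDist, Pi.smul_apply, Pi.zero_apply, sub_zero, smul_eq_mul, ← mul_sub, abs_mul,
      ← Finset.mul_sum, ENNReal.ofReal_mul (abs_nonneg a), ENNReal.mul_iSup]
  le_of_bound u B h := by
    simp only [kuiperDist, Pi.zero_apply, sub_zero]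
    refine iSup_le fun a => iSup_le fun b => iSup_le fun _ => ENNReal.ofReal_le_ofReal ?_
    calc ∑ i, |u (b i) - u (a i)| ≤ ∑ _i : Fin k, 2 * B := by
          refine Finset.sum_le_sum fun i _ => ?_
          have := abs_sub (u (b i)) (u (a i))
          linarith [h (a i), h (b i)]
      _ = 2 * k * B := by simp; ring
  le_of_tendsto u hu x := by
    have key : ∀ y ≤ x, ENNReal.ofReal |u x - u y| ≤ kuiperDist k u 0 := by
      intro y hy
      simp only [kuiperDist, Pi.zero_apply, sub_zero]
      let i₀ : Fin k := ⟨0, hk⟩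
      -- The first interval is [y, x]; the others degenerate to the point x.
      refine le_iSup_of_le (fun i => if i = i₀ then y else x) (le_iSup_of_le (fun _ => x)
        (le_iSup_of_le ⟨fun i => ?_, fun i j hij => ?_⟩ ?_))
      · dsimp only
        split_ifs <;> simp [hy]
      · have : j ≠ i₀ := fun h => by
          rw [h, Fin.lt_def] at hij
          simp [i₀] at hij
        simp [this]
      · refine ENNReal.ofReal_le_ofReal ?_
        refine le_trans ?_ (Finset.single_le_sum (fun i _ => abs_nonneg _) (Finset.mem_univ i₀))
        simp
    have hlim : Tendsto (fun y => ENNReal.ofReal |u x - u y|) atBot (𝓝 (ENNReal.ofReal |u x|)) := by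
      refine ENNReal.tendsto_ofReal ?_
      simpa using (tendsto_const_nhds (x := u x)).sub hu |>.abs
    exact le_of_tendsto hlim ((eventually_le_atBot x).mono key)

namespace IsUniformTypeDist

variable {d : (ℝ → ℝ) → (ℝ → ℝ) → ℝ≥0∞} {C : ℝ}

theorem lt_top (hd : IsUniformTypeDist d C) {u : ℝ → ℝ} {B : ℝ} (h : ∀ x, |u x| ≤ B) : d u 0 < ∞ :=
  (hd.le_of_bound u B h).trans_lt ENNReal.ofReal_lt_top

/-- If two bounded functions are uniformly close, then so are their seminorms. -/
theorem abs_toReal_sub_le (hd : IsUniformTypeDist d C)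
    {u v : ℝ → ℝ} {A B : ℝ} (hu : ∀ x, |u x| ≤ A) (huv : ∀ x, |u x - v x| ≤ B) :
    |(d u 0).toReal - (d v 0).toReal| ≤ C * B := by
  have hB : 0 ≤ B := (abs_nonneg _).trans (huv 0)
  have hCB : 0 ≤ C * B := mul_nonneg hd.nonneg hB
  have hv : ∀ x, |v x| ≤ A + B := fun x => by
    have h1 := abs_sub_abs_le_abs_sub (v x) (u x)
    rw [abs_sub_comm] at h1
    linarith [hu x, huv x]
  have huT := (hd.lt_top hu).ne
  have hvT := (hd.lt_top hv).ne
  have aux : ∀ u v : ℝ → ℝ, d v 0 ≠ ∞ → (∀ x, |u x - v x| ≤ B) →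
      (d u 0).toReal ≤ (d v 0).toReal + C * B := by
    intro u v hvT h
    have h1 : d u 0 ≤ d v 0 + ENNReal.ofReal (C * B) := by
      calc d u 0 = d (v + (u - v)) 0 := by rw [add_sub_cancel]
        _ ≤ d v 0 + d (u - v) 0 := hd.add_le _ _
        _ ≤ _ := by gcongr; exact hd.le_of_bound _ _ h
    have h2 := ENNReal.toReal_mono (by finiteness) h1
    rwa [ENNReal.toReal_add hvT ENNReal.ofReal_ne_top, ENNReal.toReal_ofReal hCB] at h2
  have h1 := aux u v hvT huv
  have h2 := aux v u huT fun x => by rw [abs_sub_comm]; exact huv x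
  rw [abs_le]
  constructor <;> linarith

end IsUniformTypeDist

/-! ### Primitives and weak derivatives -/

section Primitive

variable {v : ℝ → ℝ}

theorem setIntegral_Iic_eq_add (hv : Integrable v) (a x : ℝ) :
    ∫ t in Set.Iic x, v t = (∫ t in Set.Iic a, v t) + ∫ t in a..x, v t := by
  rw [← intervalIntegral.integral_Iic_sub_Iic hv.integrableOn hv.integrableOn]
  ring

theorem continuous_setIntegral_Iic (hv : Integrable v) :
    Continuous fun x => ∫ t in Set.Iic x, v t := by
  rw [funext (setIntegral_Iic_eq_add hv 0)]
  exact continuous_const.add (intervalIntegral.continuous_primitive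
    (fun _ _ => hv.intervalIntegrable) 0)

theorem hasDerivAt_setIntegral_Iic (hv : Integrable v) {x : ℝ} (hx : Continuous v) :
    HasDerivAt (fun x => ∫ t in Set.Iic x, v t) (v x) x := by
  rw [funext (setIntegral_Iic_eq_add hv 0)]
  exact (intervalIntegral.integral_hasDerivAt_right hv.intervalIntegrable
    (hx.stronglyMeasurableAtFilter _ _) hx.continuousAt).const_add _

theorem tendsto_setIntegral_Iic_atTop (hv : Integrable v) :
    Tendsto (fun x => ∫ t in Set.Iic x, v t) atTop (𝓝 (∫ t, v t)) :=
  (aecover_Iic tendsto_id).integral_tendsto_of_countably_generated hv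

theorem tendsto_setIntegral_Iic_atBot (hv : Integrable v) :
    Tendsto (fun x => ∫ t in Set.Iic x, v t) atBot (𝓝 0) := by
  have h := intervalIntegral_tendsto_integral_Iic (f := v) 0 hv.integrableOn tendsto_id
  have h2 := (tendsto_const_nhds (x := ∫ t in Set.Iic (0 : ℝ), v t)).sub h
  rw [sub_self] at h2
  refine h2.congr fun x => ?_
  rw [setIntegral_Iic_eq_add hv x 0]
  simp

/-- Fubini on the half-plane t ≤ x, with the integral of φ' over [t, ∞) equal to -φ(t). No
regularity of v beyond integrability is needed. -/
theorem integral_setIntegral_Iic_mul_deriv (hv : Integrable v) {φ : ℝ → ℝ}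
    (hφ : ContDiff ℝ 1 φ) (hφc : HasCompactSupport φ) :
    ∫ x, (∫ t in Set.Iic x, v t) * deriv φ x = -∫ t, v t * φ t := by
  have hdφc : HasCompactSupport (deriv φ) := hφc.deriv
  have hdφcont : Continuous (deriv φ) := hφ.continuous_deriv le_rfl
  have hdφ : Integrable (deriv φ) := hdφcont.integrable_of_hasCompactSupport hdφc
  have hS : MeasurableSet {p : ℝ × ℝ | p.2 ≤ p.1} := measurableSet_le measurable_snd measurable_fst
  have hint : Integrable (fun p : ℝ × ℝ =>
      {p : ℝ × ℝ | p.2 ≤ p.1}.indicator (fun p => deriv φ p.1 * v p.2) p)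
      (volume.prod volume) := (hdφ.mul_prod hv).indicator hS
  have h1 : ∀ x, (∫ t in Set.Iic x, v t) * deriv φ x =
      ∫ t, {p : ℝ × ℝ | p.2 ≤ p.1}.indicator (fun p => deriv φ p.1 * v p.2) (x, t) := by
    intro x
    rw [← integral_indicator measurableSet_Iic, mul_comm, ← integral_const_mul]
    refine integral_congr_ae (Eventually.of_forall fun t => ?_)
    simp only [Set.indicator, Set.mem_Iic, Set.mem_ofPred_eq, mul_ite, mul_zero]
  have h2 : ∀ t, -(v t * φ t) =
      ∫ x, {p : ℝ × ℝ | p.2 ≤ p.1}.indicator (fun p => deriv φ p.1 * v p.2) (x, t) := by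
    intro t
    have hIci : ∫ x in Set.Ici t, deriv φ x = -φ t := by
      rw [integral_Ici_eq_integral_Ioi, integral_Ioi_of_hasDerivAt_of_tendsto' (m := 0)
        (fun x _ => (hφ.differentiable (by simp) x).hasDerivAt) hdφ.integrableOn]
      · ring
      · exact hφc.is_zero_at_infty.mono_left atTop_le_cocompact
    rw [← mul_neg, ← hIci, ← integral_indicator measurableSet_Ici, ← integral_const_mul]
    refine integral_congr_ae (Eventually.of_forall fun x => ?_)
    simp only [Set.indicator, Set.mem_Ici, Set.mem_ofPred_eq, mul_ite, mul_zero, mul_comm]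
  rw [← integral_neg]
  simp_rw [h1, h2]
  exact integral_integral_swap hint

end Primitive

/-- The du Bois-Reymond lemma: a function with vanishing weak derivative is constant. -/
theorem ae_eq_const_of_integral_mul_deriv_eq_zero {w : ℝ → ℝ} (hw : LocallyIntegrable w)
    (h : ∀ φ : ℝ → ℝ, ContDiff ℝ ((⊤ : ℕ∞) : WithTop ℕ∞) φ → HasCompactSupport φ →
      ∫ x, w x * deriv φ x = 0) : ∃ c : ℝ, w =ᵐ[volume] fun _ => c := by
  let b : ContDiffBump (0 : ℝ) := default
  set θ : ℝ → ℝ := b.normed volume with hθdef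
  have hθ : ContDiff ℝ ((⊤ : ℕ∞) : WithTop ℕ∞) θ := b.contDiff_normed
  have hθc : HasCompactSupport θ := b.hasCompactSupport_normed
  have hθi : ∫ x, θ x = 1 := b.integral_normed
  refine ⟨∫ x, w x * θ x, ?_⟩
  have hprod : ∀ φ : ℝ → ℝ, Continuous φ → HasCompactSupport φ →
      Integrable fun x => w x * φ x := fun φ hφ hφc => by
    simpa [mul_comm] using hw.integrable_smul_left_of_hasCompactSupport hφ hφc
  have key := ae_eq_zero_of_integral_contDiff_smul_eq_zero
    (f := fun x => w x - ∫ x, w x * θ x) (μ := volume)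
    (hw.sub (continuous_const.locallyIntegrable)) ?_
  · filter_upwards [key] with x hx
    linarith
  intro φ hφ hφc
  set m := ∫ x, φ x with hm
  -- Subtracting mθ gives mean zero, so the primitive ψ of χ is again compactly supported and is an
  -- admissible test function. Testing with it gives ∫ wχ = 0, that is ∫ wφ = m ∫ wθ.
  set χ : ℝ → ℝ := fun x => φ x - m * θ x with hχ
  have hχs : ContDiff ℝ ((⊤ : ℕ∞) : WithTop ℕ∞) χ := hφ.sub (contDiff_const.mul hθ)
  have hχc : HasCompactSupport χ := hφc.sub (hθc.mul_left (f := fun _ => m))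
  have hφI : Integrable φ := hφ.continuous.integrable_of_hasCompactSupport hφc
  have hθI : Integrable θ := hθ.continuous.integrable_of_hasCompactSupport hθc
  have hχI : Integrable χ := hχs.continuous.integrable_of_hasCompactSupport hχc
  have hχ0 : ∫ x, χ x = 0 := by
    rw [hχ, integral_sub hφI (hθI.const_mul m), integral_const_mul, hθi]
    simp [hm]
  set ψ : ℝ → ℝ := fun x => ∫ t in Set.Iic x, χ t with hψ
  have hψd : ∀ x, HasDerivAt ψ (χ x) x := fun x => hasDerivAt_setIntegral_Iic hχI hχs.continuous
  have hψd' : deriv ψ = χ := funext fun x => (hψd x).deriv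
  have hψs : ContDiff ℝ ((⊤ : ℕ∞) : WithTop ℕ∞) ψ := by
    rw [contDiff_infty_iff_deriv, hψd']
    exact ⟨fun x => (hψd x).differentiableAt, hχs⟩
  have hψc : HasCompactSupport ψ := by
    obtain ⟨R, hR⟩ := hχc.isCompact.isBounded.subset_closedBall 0
    refine HasCompactSupport.intro (isCompact_closedBall (0 : ℝ) R) fun x hx => ?_
    have hout : ∀ t, R < |t| → χ t = 0 := fun t ht => by
      by_contra hne
      have := hR (subset_tsupport _ hne)
      simp only [Metric.mem_closedBall, dist_zero_right, Real.norm_eq_abs] at this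
      linarith
    simp only [Metric.mem_closedBall, dist_zero_right, Real.norm_eq_abs, not_le] at hx
    rcases lt_abs.mp hx with hx | hx
    · have h1 : ψ x = ∫ t, χ t := by
        refine setIntegral_eq_integral_of_forall_compl_eq_zero fun t ht => hout t ?_
        simp only [Set.mem_Iic, not_le] at ht
        exact lt_abs.mpr (Or.inl (hx.trans ht))
      rw [h1, hχ0]
    · refine setIntegral_eq_zero_of_forall_eq_zero fun t ht => hout t ?_
      simp only [Set.mem_Iic] at ht
      exact lt_abs.mpr (Or.inr (by linarith))
  have h0 := h ψ hψs hψc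
  rw [hψd'] at h0
  have e1 : ∫ x, w x * χ x = (∫ x, w x * φ x) - m * ∫ x, w x * θ x := by
    rw [← integral_const_mul, ← integral_sub (hprod φ hφ.continuous hφc)
      ((hprod θ hθ.continuous hθc).const_mul m)]
    refine integral_congr_ae (Eventually.of_forall fun x => ?_)
    simp only [hχ]; ring
  have e2 : ∫ x, φ x • (w x - ∫ x, w x * θ x) = (∫ x, w x * φ x) - m * ∫ x, w x * θ x := by
    rw [hm, ← integral_mul_const, ← integral_sub (hprod φ hφ.continuous hφc)
      (hφI.mul_const _)]
    refine integral_congr_ae (Eventually.of_forall fun x => ?_)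
    simp only [smul_eq_mul]; ring
  rw [e2, ← e1, h0]

/-- A nonzero limit would keep |u| away from 0 on a half-line, which has infinite measure. -/
theorem eq_zero_of_integrable_of_tendsto {u : ℝ → ℝ} (hu : Integrable u) {c : ℝ}
    (h : Tendsto u atTop (𝓝 c) ∨ Tendsto u atBot (𝓝 c)) : c = 0 := by
  rcases h with h | h
  · refine IntegrableAtFilter.eq_zero_of_tendsto (μ := volume) (hu.integrableAtFilter _) ?_ h
    intro s hs
    obtain ⟨b, hb⟩ := mem_atTop_sets.mp hs
    rw [← top_le_iff, ← Real.volume_Ici (a := b)]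
    exact measure_mono hb
  · refine IntegrableAtFilter.eq_zero_of_tendsto (μ := volume) (hu.integrableAtFilter _) ?_ h
    intro s hs
    obtain ⟨b, hb⟩ := mem_atBot_sets.mp hs
    rw [← top_le_iff, ← Real.volume_Iic (a := b)]
    exact measure_mono hb

/-- An integrable function with an integrable weak derivative is the primitive of the latter. -/
theorem ae_eq_setIntegral_Iic_of_weakDeriv {u v : ℝ → ℝ} (hu : Integrable u) (hv : Integrable v)
    (h : ∀ φ : ℝ → ℝ, ContDiff ℝ ((⊤ : ℕ∞) : WithTop ℕ∞) φ → HasCompactSupport φ →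
      ∫ x, u x * deriv φ x = -∫ x, v x * φ x) :
    (u =ᵐ[volume] fun x => ∫ t in Set.Iic x, v t) ∧ ∫ t, v t = 0 := by
  set w : ℝ → ℝ := fun x => ∫ t in Set.Iic x, v t with hw
  have hwc : Continuous w := continuous_setIntegral_Iic hv
  obtain ⟨c, hc⟩ := ae_eq_const_of_integral_mul_deriv_eq_zero (w := u - w)
    (hu.locallyIntegrable.sub hwc.locallyIntegrable) fun φ hφ hφc => by
      have hdφc : HasCompactSupport (deriv φ) := hφc.deriv
      have hdφcont : Continuous (deriv φ) := hφ.continuous_deriv (by simp)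
      have i1 : Integrable fun x => u x * deriv φ x := by
        simpa [mul_comm] using
          hu.locallyIntegrable.integrable_smul_left_of_hasCompactSupport hdφcont hdφc
      have i2 : Integrable fun x => w x * deriv φ x := by
        simpa [mul_comm] using
          hwc.locallyIntegrable.integrable_smul_left_of_hasCompactSupport hdφcont hdφc
      simp only [Pi.sub_apply, sub_mul]
      rw [integral_sub i1 i2, h φ hφ hφc,
        integral_setIntegral_Iic_mul_deriv hv (hφ.of_le (by simp)) hφc, sub_self]
  have hcu : (fun x => w x + c) =ᵐ[volume] u := by
    filter_upwards [hc] with x hx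
    simp only [Pi.sub_apply] at hx
    linarith
  have hint : Integrable fun x => w x + c := hu.congr hcu.symm
  -- The limit at -∞ kills the constant of integration; the limit at +∞ then gives ∫ v = 0.
  have c0 : 0 + c = 0 := eq_zero_of_integrable_of_tendsto hint
    (Or.inr ((tendsto_setIntegral_Iic_atBot hv).add_const c))
  have c1 : (∫ t, v t) + c = 0 := eq_zero_of_integrable_of_tendsto hint
    (Or.inl ((tendsto_setIntegral_Iic_atTop hv).add_const c))
  rw [zero_add] at c0
  refine ⟨?_, by simpa [c0] using c1⟩
  filter_upwards [hcu] with x hx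
  simpa [c0] using hx.symm

/-- Structure of a function in `W^{ℓ,1}`: its primitive is `ℓ` times continuously differentiable,
and the derivatives vanish at infinity. -/
theorem MemSobolevL1.exists_chain {ℓ : ℕ} (hℓ : 1 ≤ ℓ) {f : ℝ → ℝ} (hf : MemSobolevL1 ℓ f) :
    ∃ H : ℕ → ℝ → ℝ, (H 0 = fun x => ∫ t in Set.Iic x, f t) ∧
      (∀ j < ℓ, ∀ x, HasDerivAt (H j) (H (j + 1) x) x) ∧
      (∀ j, 1 ≤ j → j ≤ ℓ → Continuous (H j) ∧ Integrable (H j) ∧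
        Tendsto (H j) atBot (𝓝 0) ∧ Tendsto (H j) atTop (𝓝 0)) ∧
      (∀ j, 1 ≤ j → j ≤ ℓ → H (j - 1) = fun x => ∫ t in Set.Iic x, H j t) ∧
      f =ᵐ[volume] H 1 ∧ IsWeakDeriv (ℓ - 1) f (H ℓ) := by
  -- At order 0 the choice is forced to be f itself, so that the chain starts at the primitive of f.
  have hex : ∀ j, ∃ g : ℝ → ℝ, (j = 0 → g = f) ∧ (j ≤ ℓ → Integrable g ∧ IsWeakDeriv j f g) := by
    intro j
    rcases Nat.eq_zero_or_pos j with rfl | hj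
    · refine ⟨f, fun _ => rfl, fun _ => ⟨hf.1, hf.1.locallyIntegrable, hf.1.locallyIntegrable, ?_⟩⟩
      intro φ _ _
      simp
    · by_cases hjl : j ≤ ℓ
      · obtain ⟨g, hg, hgw⟩ := hf.2 j hj hjl
        exact ⟨g, fun h => by omega, fun _ => ⟨hg, hgw⟩⟩
      · exact ⟨0, fun h => by omega, fun h => absurd h hjl⟩
  choose g hg0 hg using hex
  have hstep : ∀ j < ℓ, (g j =ᵐ[volume] fun x => ∫ t in Set.Iic x, g (j + 1) t) ∧
      ∫ t, g (j + 1) t = 0 := by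
    intro j hj
    refine ae_eq_setIntegral_Iic_of_weakDeriv (hg j hj.le).1 (hg (j + 1) hj).1 fun φ hφ hφc => ?_
    have h1 := (hg j hj.le).2.2.2 (deriv φ) (contDiff_infty_iff_deriv.mp hφ).2 hφc.deriv
    have h2 := (hg (j + 1) hj).2.2.2 φ hφ hφc
    rw [iteratedDeriv_succ', h1, pow_succ, mul_assoc] at h2
    have := mul_left_cancel₀ (pow_ne_zero j (by norm_num : (-1 : ℝ) ≠ 0)) h2
    linarith
  -- Note the shift: `H j` is the primitive of the j-th weak derivative, hence the continuous
  -- version of the (j-1)-th one. Thus `H 0` is the distribution function and `H ℓ` represents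
  -- f^{(ℓ-1)}.
  set H : ℕ → ℝ → ℝ := fun j x => ∫ t in Set.Iic x, g j t with hH
  have hae : ∀ j, 1 ≤ j → j ≤ ℓ → g (j - 1) =ᵐ[volume] H j := fun j h1 h2 => by
    have := (hstep (j - 1) (by omega)).1
    rwa [Nat.sub_add_cancel h1] at this
  have hcont : ∀ j, 1 ≤ j → j ≤ ℓ → Continuous (H j) ∧ Integrable (H j) ∧
        Tendsto (H j) atBot (𝓝 0) ∧ Tendsto (H j) atTop (𝓝 0) := by
    intro j h1 h2
    refine ⟨continuous_setIntegral_Iic (hg j h2).1,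
      ((hg (j - 1) (by omega)).1).congr (hae j h1 h2),
      tendsto_setIntegral_Iic_atBot (hg j h2).1, ?_⟩
    have h3 := (hstep (j - 1) (by omega)).2
    rw [Nat.sub_add_cancel h1] at h3
    have h4 := tendsto_setIntegral_Iic_atTop (hg j h2).1
    rwa [h3] at h4
  have hprim : ∀ j, 1 ≤ j → j ≤ ℓ → H (j - 1) = fun x => ∫ t in Set.Iic x, H j t := by
    intro j h1 h2
    funext x
    exact integral_congr_ae (ae_restrict_of_ae (hae j h1 h2))
  refine ⟨H, ?_, ?_, hcont, hprim, ?_, ?_⟩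
  · simp only [hH, hg0 0 rfl]
  · intro j hj x
    obtain ⟨h1, h2, -⟩ := hcont (j + 1) (by omega) hj
    have h3 := hasDerivAt_setIntegral_Iic h2 (x := x) h1
    rwa [← hprim (j + 1) (by omega) hj] at h3
  · have := hae 1 le_rfl hℓ
    rwa [Nat.sub_self, hg0 0 rfl] at this
  · have h1 := (hg (ℓ - 1) (by omega)).2
    refine ⟨h1.1, (hcont ℓ hℓ le_rfl).1.locallyIntegrable, fun φ hφ hφc => ?_⟩
    rw [h1.2.2 φ hφ hφc]
    congr 1
    refine integral_congr_ae ?_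
    filter_upwards [hae ℓ hℓ le_rfl] with x hx
    rw [hx]

/-! ### Kernel smoothing and the bias expansion -/

/-- The function `x ↦ ∫ F(x - hu) K(u) du`. -/
noncomputable def kernelSmooth (K : ℝ → ℝ) (h : ℝ) (F : ℝ → ℝ) (x : ℝ) : ℝ :=
  ∫ u, F (x - h * u) * K u

theorem integrable_kernelSmooth_integrand {K F : ℝ → ℝ} (hK : Integrable K) (hF : Measurable F)
    {B : ℝ} (hB : ∀ x, |F x| ≤ B) (h x : ℝ) : Integrable fun u => F (x - h * u) * K u :=
  hK.bdd_mul (c := B) (hF.comp (by fun_prop)).aestronglyMeasurable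
    (Eventually.of_forall fun u => hB _)

theorem abs_kernelSmooth_le {K F : ℝ → ℝ} (hK : Integrable K)
    {B : ℝ} (hB : ∀ x, |F x| ≤ B) (h x : ℝ) : |kernelSmooth K h F x| ≤ B * ∫ u, |K u| := by
  rw [← integral_const_mul]
  refine abs_integral_le_integral_abs.trans (integral_mono_of_nonneg
    (Eventually.of_forall fun u => abs_nonneg _) (hK.abs.const_mul B)
    (Eventually.of_forall fun u => ?_))
  simp only [abs_mul]
  exact mul_le_mul_of_nonneg_right (hB _) (abs_nonneg _)

theorem kernelSmooth_sub {K F G : ℝ → ℝ} (hK : Integrable K) (hF : Measurable F)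
    (hG : Measurable G) {A B : ℝ} (hA : ∀ x, |F x| ≤ A) (hB : ∀ x, |G x| ≤ B) (h x : ℝ) :
    kernelSmooth K h (F - G) x = kernelSmooth K h F x - kernelSmooth K h G x := by
  unfold kernelSmooth
  rw [← integral_sub (integrable_kernelSmooth_integrand hK hF hA h x)
    (integrable_kernelSmooth_integrand hK hG hB h x)]
  simp only [Pi.sub_apply, sub_mul]

/-- Taylor's formula, with a bound on the remainder by the oscillation of the last derivative. -/
theorem abs_sub_taylor_le (n : ℕ) (H : ℕ → ℝ → ℝ)
    (hH : ∀ j < n, ∀ x, HasDerivAt (H j) (H (j + 1) x) x) (x y B : ℝ)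
    (hB : ∀ z, |z| ≤ |y| → |H n (x + z) - H n x| ≤ B) :
    |H 0 (x + y) - ∑ j ∈ Finset.range (n + 1), y ^ j / (j.factorial : ℝ) * H j x| ≤ B * |y| ^ n := by
  induction n generalizing H y with
  | zero => simpa using hB y le_rfl
  | succ n ih =>
    have hB0 : 0 ≤ B := (abs_nonneg _).trans (hB y le_rfl)
    -- The derivative of this remainder is the remainder of order n for the shifted family `H (j +
    -- 1)`. The induction hypothesis bounds it on the whole ball |z| ≤ |y|, and the mean value
    -- inequality supplies the extra factor |y|.
    let r : ℝ → ℝ := fun z =>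
      H 0 (x + z) - ∑ j ∈ Finset.range (n + 2), z ^ j / (j.factorial : ℝ) * H j x
    let r' : ℝ → ℝ := fun z =>
      H 1 (x + z) - ∑ j ∈ Finset.range (n + 1), z ^ j / (j.factorial : ℝ) * H (j + 1) x
    have hr : ∀ z, HasDerivAt r (r' z) z := by
      intro z
      refine HasDerivAt.sub ?_ ?_
      · simpa using HasDerivAt.comp_const_add x z (hH 0 n.succ_pos (x + z))
      · have h1 : HasDerivAt
            (fun z : ℝ => ∑ j ∈ Finset.range (n + 2), z ^ j / (j.factorial : ℝ) * H j x)
            (∑ j ∈ Finset.range (n + 2), (j * z ^ (j - 1)) / (j.factorial : ℝ) * H j x) z :=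
          HasDerivAt.fun_sum fun j _ => ((hasDerivAt_pow j z).div_const _).mul_const _
        refine h1.congr_deriv ?_
        rw [Finset.sum_range_succ' _ (n + 1)]
        simp only [Nat.cast_zero, zero_mul, zero_div, add_zero, Nat.add_sub_cancel]
        refine Finset.sum_congr rfl fun j _ => ?_
        rw [Nat.factorial_succ]
        push_cast
        have : (j.factorial : ℝ) ≠ 0 := by positivity
        field_simp
    have hr0 : r 0 = 0 := by
      simp only [r, Finset.sum_range_succ' _ (n + 1)]
      simp
    have hbound : ∀ z ∈ Metric.closedBall (0 : ℝ) |y|, ‖r' z‖ ≤ B * |y| ^ n := by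
      intro z hz
      rw [mem_closedBall_zero_iff, Real.norm_eq_abs] at hz
      refine (ih (fun j => H (j + 1)) (fun j hj => hH (j + 1) (by omega)) z
        fun w hw => hB w (hw.trans hz)).trans ?_
      gcongr
    have := (convex_closedBall (0 : ℝ) |y|).norm_image_sub_le_of_norm_hasDerivWithin_le
      (fun z _ => (hr z).hasDerivWithinAt) hbound (x := 0) (y := y) (by simp) (by simp)
    rw [hr0, sub_zero, sub_zero, Real.norm_eq_abs, Real.norm_eq_abs, mul_assoc, ← pow_succ] at this
    exact this

/-- The uniform expansion of the bias of a kernel estimator. -/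
theorem kernelSmooth_bias {ℓ : ℕ} {K : ℝ → ℝ} (hK : IsKernelOfOrder ℓ K) {H : ℕ → ℝ → ℝ}
    (hH : ∀ j < ℓ, ∀ x, HasDerivAt (H j) (H (j + 1) x) x) (hcont : UniformContinuous (H ℓ))
    {M : ℝ} (hM : ∀ x, |H ℓ x| ≤ M) {B : ℝ} (hB : ∀ x, |H 0 x| ≤ B) {ε : ℝ} (hε : 0 < ε) :
    ∀ᶠ h : ℝ in 𝓝[>] 0, ∀ x, |H 0 x - kernelSmooth K h (H 0) x
      - (-((-1) ^ ℓ * kernelMoment K ℓ / (ℓ.factorial : ℝ)) * h ^ ℓ) * H ℓ x| ≤ ε * h ^ ℓ := by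
  have hℓ := hK.one_le
  have hK0 : Integrable K := by simpa using hK.integrable 0 (Nat.zero_le _)
  have hM0 : 0 ≤ M := (abs_nonneg _).trans (hM 0)
  have hmeas : Measurable (H 0) := by
    refine Continuous.measurable (continuous_iff_continuousAt.mpr fun x => (hH 0 hℓ x).continuousAt)
  have hKℓ : Integrable fun u => |u| ^ ℓ * |K u| := by
    simpa [abs_mul] using (hK.integrable ℓ le_rfl).abs
  set A := ∫ u, |u| ^ ℓ * |K u| with hA
  have hA0 : 0 ≤ A := integral_nonneg fun u => by positivity
  -- The +1 covers A = 0 and keeps ηA < ε strict.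
  set η := ε / (2 * (A + 1)) with hη
  have hηpos : 0 < η := by positivity
  have hηA : η * A < ε := by
    rw [hη, div_mul_eq_mul_div, div_lt_iff₀ (by positivity)]
    nlinarith
  obtain ⟨δ, hδ, hUC⟩ := Metric.uniformContinuous_iff.mp hcont η hηpos
  -- A majorant of the Taylor remainder times |K u|, divided by h^ℓ: the oscillation of `H ℓ` is at
  -- most η when |hu| < δ and at most 2M otherwise. The second part disappears as h → 0 by dominated
  -- convergence. The bound does not involve x, so the expansion is uniform.
  let ψ : ℝ → ℝ → ℝ := fun h u =>
    (η + {u : ℝ | δ ≤ |h * u|}.indicator (fun _ => 2 * M) u) * (|u| ^ ℓ * |K u|)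
  have hψm : ∀ h, Measurable fun u => η + {u : ℝ | δ ≤ |h * u|}.indicator (fun _ => 2 * M) u :=
    fun h => measurable_const.add (measurable_const.indicator
      (measurableSet_le measurable_const (by fun_prop)))
  have hψb : ∀ h u, |η + {u : ℝ | δ ≤ |h * u|}.indicator (fun _ => 2 * M) u| ≤ η + 2 * M := by
    intro h u
    rw [abs_of_nonneg (add_nonneg hηpos.le (Set.indicator_nonneg (fun _ _ => by positivity) _))]
    gcongr
    exact Set.indicator_le_self' (fun _ _ => by positivity) u
  have hψint : ∀ h, Integrable (ψ h) := fun h =>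
    hKℓ.bdd_mul (hψm h).aestronglyMeasurable (Eventually.of_forall (hψb h))
  have hlim : Tendsto (fun h => ∫ u, ψ h u) (𝓝[>] 0) (𝓝 (∫ u, η * (|u| ^ ℓ * |K u|))) := by
    refine tendsto_integral_filter_of_dominated_convergence
      (fun u => (η + 2 * M) * (|u| ^ ℓ * |K u|))
      (Eventually.of_forall fun h => (hψint h).aestronglyMeasurable)
      (Eventually.of_forall fun h => Eventually.of_forall fun u => ?_)
      (hKℓ.const_mul _) (Eventually.of_forall fun u => ?_)
    · simp only [ψ, norm_mul, Real.norm_eq_abs, abs_abs, abs_pow]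
      exact mul_le_mul_of_nonneg_right (hψb h u) (by positivity)
    · refine tendsto_const_nhds.congr' ?_
      have ht : Tendsto (fun h : ℝ => |h * u|) (𝓝[>] 0) (𝓝 0) := by
        have : Continuous fun h : ℝ => |h * u| := by fun_prop
        simpa using (this.tendsto 0).mono_left nhdsWithin_le_nhds
      filter_upwards [ht.eventually_lt_const hδ] with h hh
      have : u ∉ {u : ℝ | δ ≤ |h * u|} := by simpa using hh
      simp only [ψ, Set.indicator_of_notMem this, add_zero]
  rw [integral_const_mul] at hlim
  filter_upwards [hlim.eventually_lt_const hηA, self_mem_nhdsWithin] with h hh hpos x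
  simp only [Set.mem_Ioi] at hpos
  let T : ℝ → ℝ := fun u => ∑ j ∈ Finset.range (ℓ + 1), (-(h * u)) ^ j / (j.factorial : ℝ) * H j x
  have hT : ∀ u, T u * K u = ∑ j ∈ Finset.range (ℓ + 1),
      ((-h) ^ j / (j.factorial : ℝ) * H j x) * (u ^ j * K u) := fun u => by
    simp only [T, Finset.sum_mul]
    refine Finset.sum_congr rfl fun j _ => ?_
    rw [← neg_mul, mul_pow]
    ring
  have hTint : Integrable fun u => T u * K u := by
    simp_rw [hT]
    exact integrable_finsetSum _ fun j hj =>
      (hK.integrable j (Nat.lt_succ_iff.mp (Finset.mem_range.mp hj))).const_mul _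
  have hTI : ∫ u, T u * K u =
      H 0 x + ((-1) ^ ℓ * kernelMoment K ℓ / (ℓ.factorial : ℝ)) * h ^ ℓ * H ℓ x := by
    simp_rw [hT]
    rw [integral_finsetSum _ fun j hj =>
      (hK.integrable j (Nat.lt_succ_iff.mp (Finset.mem_range.mp hj))).const_mul _]
    simp_rw [integral_const_mul]
    have hm : ∀ j, ∫ u, u ^ j * K u = kernelMoment K j := fun j => rfl
    simp_rw [hm]
    -- Peel off the terms j = 0 and j = ℓ; the moments in between vanish.
    obtain ⟨m, rfl⟩ : ∃ m, ℓ = m + 1 := ⟨ℓ - 1, by omega⟩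
    rw [Finset.sum_range_succ, Finset.sum_range_succ', Finset.sum_eq_zero]
    · simp only [hK.moment_zero]
      rw [neg_pow]
      simp
      ring
    · intro j hj
      rw [hK.moment_mid (j + 1) (by omega) (by have := Finset.mem_range.mp hj; omega), mul_zero]
  have hRint := (integrable_kernelSmooth_integrand hK0 hmeas hB h x).sub hTint
  have hRI : H 0 x - kernelSmooth K h (H 0) x
      - (-((-1) ^ ℓ * kernelMoment K ℓ / (ℓ.factorial : ℝ)) * h ^ ℓ) * H ℓ x =
      - ∫ u, (H 0 (x - h * u) * K u - T u * K u) := by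
    rw [integral_sub (integrable_kernelSmooth_integrand hK0 hmeas hB h x) hTint, hTI]
    unfold kernelSmooth
    ring
  rw [hRI, abs_neg]
  have hle : ∀ u, |H 0 (x - h * u) * K u - T u * K u| ≤ h ^ ℓ * ψ h u := by
    intro u
    rw [← sub_mul, abs_mul]
    have h1 := abs_sub_taylor_le ℓ H hH x (-(h * u))
      (η + {u : ℝ | δ ≤ |h * u|}.indicator (fun _ => 2 * M) u) fun z hz => by
        rw [abs_neg] at hz
        by_cases hu : δ ≤ |h * u|
        · rw [Set.indicator_of_mem (by simpa using hu)]
          have := abs_sub (H ℓ (x + z)) (H ℓ x)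
          linarith [hM (x + z), hM x]
        · rw [Set.indicator_of_notMem (by simpa using hu), add_zero]
          have := hUC (a := x + z) (b := x) (by
            rw [Real.dist_eq, add_sub_cancel_left]
            linarith)
          rw [Real.dist_eq] at this
          exact this.le
    rw [← sub_eq_add_neg] at h1
    refine (mul_le_mul_of_nonneg_right h1 (abs_nonneg (K u))).trans (le_of_eq ?_)
    simp only [ψ, abs_neg, abs_mul, abs_of_pos hpos, mul_pow]
    ring
  calc |∫ u, (H 0 (x - h * u) * K u - T u * K u)|
      ≤ ∫ u, |H 0 (x - h * u) * K u - T u * K u| := abs_integral_le_integral_abs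
    _ ≤ ∫ u, h ^ ℓ * ψ h u := integral_mono hRint.abs ((hψint h).const_mul _) hle
    _ = h ^ ℓ * ∫ u, ψ h u := integral_const_mul _ _
    _ ≤ h ^ ℓ * ε := by gcongr
    _ = ε * h ^ ℓ := mul_comm _ _

/-! ### Lower bound for the bias away from bandwidth zero -/

open scoped FourierTransform Convolution in
/-- An integrable function of nonzero integral is not reproduced by convolution with a kernel that
has a nonvanishing moment of positive order. -/
theorem exists_ne_kernelSmooth {ℓ : ℕ} (hℓ : 1 ≤ ℓ) {K : ℝ → ℝ}
    (hK : ∀ j : ℕ, j ≤ ℓ → Integrable (fun u : ℝ => u ^ j * K u)) (hm : kernelMoment K ℓ ≠ 0)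
    {q : ℝ → ℝ} (hq : Integrable q) (hq0 : ∫ x, q x ≠ 0) {h : ℝ} (hh : 0 < h) :
    ∃ x, q x ≠ kernelSmooth K h q x := by
  by_contra! hcon
  let k : ℝ → ℂ := fun t => ((h⁻¹ * K (h⁻¹ * t) : ℝ) : ℂ)
  let Q : ℝ → ℂ := fun x => (q x : ℂ)
  have hhi : h⁻¹ ≠ 0 := inv_ne_zero hh.ne'
  have hkj : ∀ j : ℕ, j ≤ ℓ → Integrable fun t : ℝ => t ^ j • k t := by
    intro j hj
    have h1 := ((hK j hj).comp_mul_left' hhi).const_mul (h ^ j * h⁻¹)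
    refine h1.ofReal.congr (Eventually.of_forall fun t => ?_)
    simp only [k, Complex.real_smul]
    rw [← Complex.ofReal_mul]
    congr 1
    change h ^ j * h⁻¹ * ((h⁻¹ * t) ^ j * K (h⁻¹ * t)) = t ^ j * (h⁻¹ * K (h⁻¹ * t))
    rw [mul_pow, inv_pow]
    have : h ^ j ≠ 0 := pow_ne_zero j hh.ne'
    field_simp
  have hk : Integrable k := by simpa using hkj 0 (Nat.zero_le _)
  have hQ : Integrable Q := hq.ofReal
  have hconv : (k ⋆[ContinuousLinearMap.mul ℂ ℂ] Q : ℝ → ℂ) = Q := by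
    funext x
    rw [convolution_def]
    simp only [ContinuousLinearMap.mul_apply', Q]
    have h1 := Measure.integral_comp_mul_left (fun t => (h⁻¹ * K (h⁻¹ * t)) * q (x - t)) h
    have h2 : ∀ u, h⁻¹ * K (h⁻¹ * (h * u)) * q (x - h * u) = h⁻¹ * (q (x - h * u) * K u) := by
      intro u
      rw [inv_mul_cancel_left₀ hh.ne']
      ring
    simp_rw [h2] at h1
    rw [integral_const_mul, abs_of_pos (inv_pos.mpr hh), smul_eq_mul] at h1
    have h3 := mul_left_cancel₀ hhi h1
    rw [hcon x]
    unfold kernelSmooth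
    rw [h3, ← integral_complex_ofReal]
    simp [k]
  -- The transform of the dilated kernel equals 1 wherever that of q is nonzero, which includes a
  -- neighbourhood of 0 because ∫ q ≠ 0.
  have hF : ∀ ξ, 𝓕 k ξ * 𝓕 Q ξ = 𝓕 Q ξ := fun ξ => by
    rw [← Real.fourier_mul_convolution_eq hk hQ ξ, hconv]
  have hQ0 : 𝓕 Q 0 ≠ 0 := by
    rw [Real.fourier_real_eq]
    simp only [mul_zero, neg_zero, AddChar.map_zero_eq_one, one_smul, Q]
    rw [integral_complex_ofReal]
    exact_mod_cast hq0
  have hQc : Continuous (𝓕 Q) :=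
    VectorFourier.fourierIntegral_continuous Real.continuous_fourierChar
      (by exact continuous_inner) hQ
  have hev : 𝓕 k =ᶠ[𝓝 0] fun _ => (1 : ℂ) := by
    filter_upwards [hQc.continuousAt.eventually_ne hQ0] with ξ hξ
    exact mul_right_cancel₀ hξ (by rw [hF, one_mul])
  -- The ℓ-th derivative at 0 vanishes for the constant 1, since ℓ ≥ 1, but for the kernel it is a
  -- nonzero multiple of the ℓ-th moment.
  have hder := hev.iteratedDeriv_eq ℓ
  rw [Real.iteratedDeriv_fourier (N := ℓ) (fun j hj => hkj j (by exact_mod_cast hj)) le_rfl,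
    iteratedDeriv_const, if_neg (by omega), Real.fourier_real_eq] at hder
  simp only [mul_zero, neg_zero, AddChar.map_zero_eq_one, one_smul, smul_eq_mul] at hder
  have e1 : ∀ t : ℝ, (-2 * (Real.pi : ℂ) * Complex.I * (t : ℂ)) ^ ℓ * k t =
      (-2 * (Real.pi : ℂ) * Complex.I) ^ ℓ * ((t ^ ℓ * (h⁻¹ * K (h⁻¹ * t)) : ℝ) : ℂ) := fun t => by
    simp only [k]
    rw [mul_pow]
    push_cast
    ring
  simp_rw [e1] at hder
  rw [integral_const_mul, integral_complex_ofReal, mul_eq_zero] at hder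
  rcases hder with h0 | h0
  · exact pow_ne_zero ℓ (by simp [Real.pi_ne_zero]) h0
  · rw [Complex.ofReal_eq_zero] at h0
    have h1 := Measure.integral_comp_mul_left (fun t : ℝ => t ^ ℓ * (h⁻¹ * K (h⁻¹ * t))) h
    have h2 : ∀ u, (h * u) ^ ℓ * (h⁻¹ * K (h⁻¹ * (h * u))) = (h ^ ℓ * h⁻¹) * (u ^ ℓ * K u) := by
      intro u
      rw [inv_mul_cancel_left₀ hh.ne', mul_pow]
      ring
    simp_rw [h2] at h1
    rw [h0, smul_zero, integral_const_mul, mul_eq_zero] at h1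
    rcases h1 with h1 | h1
    · exact mul_ne_zero (pow_ne_zero _ hh.ne') hhi h1
    · exact hm h1

/-- Dominated convergence with majorant B|K|. Bandwidth and point may both move, which covers limits
in h as well as the limit as x → -∞. -/
theorem tendsto_kernelSmooth {ι : Type*} {l : Filter ι} [l.IsCountablyGenerated] {K F : ℝ → ℝ}
    (hK : Integrable K)
    (hF : Measurable F) {B : ℝ} (hB : ∀ x, |F x| ≤ B) {h x : ι → ℝ} {G : ℝ → ℝ}
    (hlim : ∀ᵐ u, Tendsto (fun i => F (x i - h i * u)) l (𝓝 (G u))) :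
    Tendsto (fun i => kernelSmooth K (h i) F (x i)) l (𝓝 (∫ u, G u * K u)) := by
  refine tendsto_integral_filter_of_dominated_convergence (fun u => B * |K u|)
    (Eventually.of_forall fun i =>
      (integrable_kernelSmooth_integrand hK hF hB (h i) (x i)).aestronglyMeasurable)
    (Eventually.of_forall fun i => Eventually.of_forall fun u => ?_) (hK.abs.const_mul B) ?_
  · rw [norm_mul]
    exact mul_le_mul_of_nonneg_right (hB _) (abs_nonneg _)
  · filter_upwards [hlim] with u hu
    exact hu.mul_const _

/-- The bias of a kernel estimator stays away from zero when the bandwidth does. -/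
theorem exists_le_abs_sub_kernelSmooth {ℓ : ℕ} {K : ℝ → ℝ} (hK : IsKernelOfOrder ℓ K)
    {F q : ℝ → ℝ} (hF : ∀ x, HasDerivAt F (q x) x) (hq : Integrable q) (hqc : Continuous q)
    (hqi : ∫ x, q x ≠ 0) {M : ℝ} (hM : ∀ x, |q x| ≤ M) {B : ℝ} (hB : ∀ x, |F x| ≤ B) {a b : ℝ}
    (hab : a ≠ b) (ha : Tendsto F atBot (𝓝 a)) (hb : Tendsto F atTop (𝓝 b))
    {ε : ℝ} (hε : 0 < ε) :
    ∃ δ > 0, ∀ h, ε ≤ h → ∃ x, δ ≤ |F x - kernelSmooth K h F x| := by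
  have hK0 : Integrable K := by simpa using hK.integrable 0 (Nat.zero_le _)
  have hFc : Continuous F := continuous_iff_continuousAt.mpr fun x => (hF x).continuousAt
  by_contra! hcon
  choose h hh hlt using fun n : ℕ => hcon (1 / ((n : ℝ) + 1)) (by positivity)
  have hpos : ∀ n, 0 < h n := fun n => hε.trans_le (hh n)
  -- Inverse bandwidths lie in the compact interval [0, 1/ε]; the limit t = 0 encodes h → ∞.
  obtain ⟨t, ht, φ, hφ, hlim⟩ := (isCompact_Icc (a := (0 : ℝ)) (b := ε⁻¹)).tendsto_subseq
    (x := fun n => (h n)⁻¹) fun n =>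
      ⟨(inv_pos.mpr (hpos n)).le, inv_anti₀ hε (hh n)⟩
  have hsm : ∀ x, Tendsto (fun n => kernelSmooth K (h (φ n)) F x) atTop (𝓝 (F x)) := by
    intro x
    have h1 : Tendsto (fun n : ℕ => 1 / (((φ n : ℕ) : ℝ) + 1)) atTop (𝓝 0) :=
      tendsto_one_div_add_atTop_nhds_zero_nat.comp hφ.tendsto_atTop
    refine tendsto_iff_dist_tendsto_zero.mpr
      (squeeze_zero (fun _ => dist_nonneg) (fun n => ?_) h1)
    rw [dist_comm, Real.dist_eq]
    exact (hlt (φ n) x).le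
  rcases ht.1.eq_or_lt with rfl | htpos
  · have hinf : Tendsto (fun n => h (φ n)) atTop atTop := by
      have h1 : Tendsto (fun n => (h (φ n))⁻¹) atTop (𝓝[>] 0) :=
        tendsto_nhdsWithin_iff.mpr ⟨hlim, Eventually.of_forall fun n => inv_pos.mpr (hpos _)⟩
      simpa [Pi.inv_def] using h1.inv_tendsto_nhdsGT_zero
    -- For h → ∞, F(x - hu) tends to b or a according to the sign of u, whatever x is. So F would be
    -- constant, against a ≠ b.
    have hconst : ∀ x, F x = ∫ u, (if u < 0 then b else a) * K u := by
      intro x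
      refine tendsto_nhds_unique (hsm x) (tendsto_kernelSmooth hK0 hFc.measurable hB ?_)
      filter_upwards [compl_mem_ae_iff.mpr (measure_singleton (0 : ℝ))] with u hu
      rcases lt_or_gt_of_ne (show u ≠ 0 from hu) with hu | hu
      · rw [if_pos hu]
        refine hb.comp ?_
        have := tendsto_atTop_add_const_left atTop x (hinf.atTop_mul_const (neg_pos.mpr hu))
        simpa [sub_eq_add_neg] using this
      · rw [if_neg hu.not_gt]
        refine ha.comp ?_
        have := tendsto_atBot_add_const_left atTop x
          (tendsto_neg_atTop_atBot.comp (hinf.atTop_mul_const hu))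
        simpa [sub_eq_add_neg, Function.comp_def] using this
    have hF' : F = fun _ => ∫ u, (if u < 0 then b else a) * K u := funext hconst
    rw [hF'] at ha hb
    exact hab ((tendsto_nhds_unique ha tendsto_const_nhds).trans
      (tendsto_nhds_unique hb tendsto_const_nhds).symm)
  · have hfin : Tendsto (fun n => h (φ n)) atTop (𝓝 t⁻¹) := by
      simpa [Function.comp_def] using hlim.inv₀ htpos.ne'
    -- F is not integrable, so the Fourier argument is applied to the derivative of this identity, q
    -- = K_h * q with h = 1/t.
    have hfix : ∀ x, F x = kernelSmooth K t⁻¹ F x := by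
      intro x
      refine tendsto_nhds_unique (hsm x) (tendsto_kernelSmooth hK0 hFc.measurable hB ?_)
      refine Eventually.of_forall fun u => (hFc.tendsto _).comp ?_
      exact tendsto_const_nhds.sub (hfin.mul_const u)
    obtain ⟨x, hx⟩ := exists_ne_kernelSmooth hK.one_le hK.integrable hK.moment_top hq hqi
      (inv_pos.mpr htpos)
    refine hx ((hF x).unique ?_)
    rw [funext hfix]
    refine (hasDerivAt_integral_of_dominated_loc_of_deriv_le
      (F' := fun x u => q (x - t⁻¹ * u) * K u) (bound := fun u => M * |K u|)
      univ_mem (Eventually.of_forall fun y =>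
        (integrable_kernelSmooth_integrand hK0 hFc.measurable hB _ y).aestronglyMeasurable)
      (integrable_kernelSmooth_integrand hK0 hFc.measurable hB _ x)
      (integrable_kernelSmooth_integrand hK0 hqc.measurable hM _ x).aestronglyMeasurable
      (Eventually.of_forall fun u y _ => ?_) (hK0.abs.const_mul M)
      (Eventually.of_forall fun u y _ => ?_)).2
    · rw [norm_mul]
      exact mul_le_mul_of_nonneg_right (hM _) (abs_nonneg _)
    · exact (HasDerivAt.comp_sub_const y (t⁻¹ * u) (hF (y - t⁻¹ * u))).mul_const _

/-! ### Uniform convergence of the empirical distribution function -/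

theorem empiricalCDF_eq_sum (x : ℕ → ℝ) (n : ℕ) (t : ℝ) :
    empiricalCDF x n t =
      (1 / (n : ℝ)) * ∑ i ∈ Finset.range n, (Set.Iic t).indicator (fun _ => (1 : ℝ)) (x i) := by
  simp [empiricalCDF, Set.indicator]

theorem empiricalCDF_nonneg (x : ℕ → ℝ) (n : ℕ) (t : ℝ) : 0 ≤ empiricalCDF x n t := by
  unfold empiricalCDF
  positivity

theorem empiricalCDF_le_one (x : ℕ → ℝ) (n : ℕ) (t : ℝ) : empiricalCDF x n t ≤ 1 := by
  unfold empiricalCDF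
  rw [one_div, inv_mul_eq_div]
  refine div_le_one_of_le₀ ?_ (Nat.cast_nonneg n)
  exact_mod_cast (Finset.card_filter_le _ _).trans (Finset.card_range n).le

theorem empiricalCDF_mono (x : ℕ → ℝ) (n : ℕ) : Monotone (empiricalCDF x n) := by
  intro s t hst
  unfold empiricalCDF
  gcongr

/-- Two monotone functions with values in `[0, 1]` are uniformly close if they are close on a grid
of quantiles. -/
theorem abs_sub_le_of_grid {F G : ℝ → ℝ} (hF : Monotone F) (hG : Monotone G)
    (hF0 : ∀ t, 0 ≤ F t) (hF1 : ∀ t, F t ≤ 1) (hG0 : ∀ t, 0 ≤ G t) (hG1 : ∀ t, G t ≤ 1)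
    {m : ℕ} (hm : 0 < m) {η : ℝ} (hη : 0 ≤ η) {τ : ℕ → ℝ}
    (hτ : ∀ k, 0 < k → k < m → F (τ k) = (k : ℝ) / m)
    (hclose : ∀ k, 0 < k → k < m → |G (τ k) - F (τ k)| ≤ η) (t : ℝ) :
    |G t - F t| ≤ η + 1 / (m : ℝ) := by
  have hm' : (0 : ℝ) < m := by exact_mod_cast hm
  have hFm0 : 0 ≤ F t * m := mul_nonneg (hF0 t) hm'.le
  rw [abs_le]
  constructor
  · by_cases h : F t ≤ 1 / (m : ℝ)
    · linarith [hG0 t]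
    · rw [not_le, div_lt_iff₀ hm'] at h
      -- With k = ⌈m F(t)⌉ - 1, the level k/m is the largest grid level strictly below F(t).
      -- Strictness gives τ k < t by monotonicity alone; k ≥ 1 because F(t) > 1/m.
      have hc1 := Nat.ceil_lt_add_one hFm0
      have hc2 : 1 < ⌈F t * m⌉₊ := by rw [Nat.lt_ceil]; simpa using h
      have hc3 : ⌈F t * m⌉₊ ≤ m := by
        rw [Nat.ceil_le]
        nlinarith [hF1 t]
      obtain ⟨k, hk⟩ : ∃ k, ⌈F t * m⌉₊ = k + 1 := ⟨⌈F t * m⌉₊ - 1, by omega⟩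
      have hk1 := Nat.le_ceil (F t * m)
      rw [hk] at hc1 hk1
      push_cast at hc1 hk1
      have e := hτ k (by omega) (by omega)
      have hlt : F (τ k) < F t := by
        rw [e, div_lt_iff₀ hm']
        linarith
      have hle : G (τ k) ≤ G t := hG (hF.reflect_lt hlt).le
      have h2 := (abs_le.mp (hclose k (by omega) (by omega))).1
      have h3 : F t ≤ (k : ℝ) / m + 1 / m := by
        rw [← add_div, le_div_iff₀ hm']
        exact hk1
      linarith
  · by_cases h : 1 - 1 / (m : ℝ) ≤ F t
    · linarith [hG1 t]
    · rw [not_le] at h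
      have h' : F t * m + 1 < m := by
        have := mul_lt_mul_of_pos_right h hm'
        rw [sub_mul, one_div_mul_cancel hm'.ne'] at this
        linarith
      -- Symmetrically, ⌊m F(t)⌋ + 1 is the index of the smallest grid level strictly above F(t).
      have hc1 := Nat.floor_le hFm0
      have hc2 := Nat.lt_floor_add_one (F t * m)
      set k := ⌊F t * m⌋₊
      have hkm : k + 1 < m := by
        have : ((k + 1 : ℕ) : ℝ) < m := by push_cast; linarith
        exact_mod_cast this
      have e := hτ (k + 1) (by omega) hkm
      push_cast at e
      have hlt : F t < F (τ (k + 1)) := by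
        rw [e, lt_div_iff₀ hm']
        exact hc2
      have hle : G t ≤ G (τ (k + 1)) := hG (hF.reflect_lt hlt).le
      have h2 := (abs_le.mp (hclose (k + 1) (by omega) hkm)).2
      have h3 : ((k : ℝ) + 1) / m ≤ F t + 1 / m := by
        rw [add_div]
        gcongr
        rw [div_le_iff₀ hm']
        exact hc1
      linarith

section Deviation

variable {Ω : Type*} [MeasurableSpace Ω] {P : Measure Ω} [IsProbabilityMeasure P]
  {X : ℕ → Ω → ℝ} {F : ℝ → ℝ}

/-- Hoeffding's inequality: centred indicators are subgaussian with variance proxy 1/4. The factor 2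
counts the two tails. -/
theorem measureReal_empiricalCDF_deviation_le (hX : ∀ i, Measurable (X i)) (hindep : iIndepFun X P)
    (hF : ∀ i t, P.real {ω | X i ω ≤ t} = F t) {n : ℕ} (hn : 0 < n) (t : ℝ) {η : ℝ} (hη : 0 ≤ η) :
    P.real {ω | η < |empiricalCDF (fun i => X i ω) n t - F t|} ≤
      2 * Real.exp (-2 * (n * η ^ 2)) := by
  have hn' : (0 : ℝ) < n := by exact_mod_cast hn
  let ind : ℝ → ℝ := (Set.Iic t).indicator fun _ => (1 : ℝ)
  have hind : Measurable ind := measurable_const.indicator measurableSet_Iic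
  let Y : ℕ → Ω → ℝ := fun i ω => ind (X i ω) - F t
  have hmean : ∀ i, ∫ ω, ind (X i ω) ∂P = F t := by
    intro i
    have : (fun ω => ind (X i ω)) = {ω | X i ω ≤ t}.indicator fun _ => (1 : ℝ) := rfl
    rw [this, integral_indicator_const _ (measurableSet_le (hX i) measurable_const), hF i t]
    simp
  have hsub : ∀ i, HasSubgaussianMGF (Y i) ((‖(1 : ℝ) - 0‖₊ / 2) ^ 2) P := by
    intro i
    have := hasSubgaussianMGF_of_mem_Icc (μ := P) (X := fun ω => ind (X i ω)) (a := 0) (b := 1)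
      (hind.comp (hX i)).aemeasurable (Eventually.of_forall fun ω =>
        ⟨Set.indicator_nonneg (fun _ _ => zero_le_one) _,
          Set.indicator_le_self' (fun _ _ => zero_le_one) _⟩)
    rwa [hmean i] at this
  have hY : iIndepFun Y P := hindep.comp (fun _ y => ind y - F t) fun _ => hind.sub_const _
  have hY' : iIndepFun (fun i => -Y i) P :=
    hindep.comp (fun _ y => -(ind y - F t)) fun _ => (hind.sub_const _).neg
  have hnη : 0 ≤ n * η := by positivity
  have h1 := HasSubgaussianMGF.measure_sum_range_ge_le_of_iIndepFun (n := n) hY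
    (fun i _ => hsub i) hnη
  have h2 := HasSubgaussianMGF.measure_sum_range_ge_le_of_iIndepFun (n := n) hY'
    (fun i _ => (hsub i).neg) hnη
  have hexp : -(n * η) ^ 2 / (2 * n * (((‖(1 : ℝ) - 0‖₊ / 2) ^ 2 : NNReal) : ℝ)) =
      -2 * (n * η ^ 2) := by
    simp
    field_simp
  rw [hexp] at h1 h2
  have hsum : ∀ ω, ∑ i ∈ Finset.range n, Y i ω =
      n * (empiricalCDF (fun i => X i ω) n t - F t) := by
    intro ω
    rw [empiricalCDF_eq_sum]
    simp only [Y, Finset.sum_sub_distrib, Finset.sum_const, Finset.card_range, nsmul_eq_mul]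
    field_simp
    rfl
  have hsubset : {ω | η < |empiricalCDF (fun i => X i ω) n t - F t|} ⊆
      {ω | n * η ≤ ∑ i ∈ Finset.range n, Y i ω} ∪
        {ω | n * η ≤ ∑ i ∈ Finset.range n, (-Y i) ω} := by
    intro ω hω
    simp only [Set.mem_ofPred_eq] at hω
    simp only [Set.mem_union, Set.mem_ofPred_eq, Pi.neg_apply, Finset.sum_neg_distrib, hsum]
    rcases lt_abs.mp hω with h | h
    · exact Or.inl (mul_le_mul_of_nonneg_left h.le hn'.le)
    · right
      rw [← mul_neg]
      exact mul_le_mul_of_nonneg_left h.le hn'.le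
  calc _ ≤ _ := measureReal_mono hsubset
    _ ≤ _ := measureReal_union_le _ _
    _ ≤ _ := by linarith

theorem summable_mul_exp_neg_rpow {a : ℝ} (ha : 0 < a) :
    Summable fun n : ℕ => (n : ℝ) * (2 * Real.exp (-2 * (n : ℝ) ^ a)) := by
  have h1 : Tendsto (fun n : ℕ => (n : ℝ) ^ a) atTop atTop :=
    (tendsto_rpow_atTop ha).comp tendsto_natCast_atTop_atTop
  -- The exponent 3/a turns n^a into n³, so the exponential is eventually at most n⁻³ and the series
  -- compares with ∑ n⁻².
  have h2 := (tendsto_rpow_mul_exp_neg_mul_atTop_nhds_zero (3 / a) 2 two_pos).comp h1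
  refine summable_of_isBigO_nat (g := fun n : ℕ => 1 / (n : ℝ) ^ 2)
    (Real.summable_one_div_nat_pow.mpr one_lt_two) ?_
  refine IsBigO.of_bound 2 ?_
  filter_upwards [h2.eventually_le_const zero_lt_one, eventually_gt_atTop 0] with n hn hpos
  have hn' : (0 : ℝ) < n := by exact_mod_cast hpos
  simp only [Function.comp_apply] at hn
  rw [← Real.rpow_mul hn'.le, mul_div_cancel₀ _ ha.ne'] at hn
  rw [Real.norm_of_nonneg (by positivity), Real.norm_of_nonneg (by positivity),
    mul_one_div, le_div_iff₀ (by positivity)]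
  have : (n : ℝ) ^ (3 : ℝ) = n * n ^ 2 := by
    rw [show (3 : ℝ) = ((3 : ℕ) : ℝ) by norm_num, Real.rpow_natCast]
    ring
  rw [this] at hn
  linarith

/-- The empirical distribution function converges uniformly to the distribution function at any
polynomial rate below `n^{-1/2}`, if the latter is continuous. -/
theorem ae_eventually_abs_empiricalCDF_sub_le (hX : ∀ i, Measurable (X i)) (hindep : iIndepFun X P)
    (hF : ∀ i t, P.real {ω | X i ω ≤ t} = F t) (hFc : Continuous F)
    (hbot : Tendsto F atBot (𝓝 0)) (htop : Tendsto F atTop (𝓝 1)) {β : ℝ} (hβ : β < 1 / 2) :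
    ∀ᵐ ω ∂P, ∀ᶠ n : ℕ in atTop, ∀ t,
      |empiricalCDF (fun i => X i ω) n t - F t| ≤ (n : ℝ) ^ (-β) + 1 / n := by
  have hF0 : ∀ t, 0 ≤ F t := fun t => by rw [← hF 0 t]; exact measureReal_nonneg
  have hF1 : ∀ t, F t ≤ 1 := fun t => by rw [← hF 0 t]; exact measureReal_le_one
  have hmono : Monotone F := fun s t hst => by
    rw [← hF 0 s, ← hF 0 t]
    exact measureReal_mono fun ω (hω : X 0 ω ≤ s) => hω.trans hst
  have hsurj : ∀ p : ℝ, ∃ t, 0 < p → p < 1 → F t = p := by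
    intro p
    by_cases hp : 0 < p ∧ p < 1
    · obtain ⟨t, ht⟩ := mem_range_of_exists_le_of_exists_ge hFc
        ((hbot.eventually_le_const hp.1).exists) ((htop.eventually_const_le hp.2).exists)
      exact ⟨t, fun _ _ => ht⟩
    · exact ⟨0, fun h1 h2 => absurd ⟨h1, h2⟩ hp⟩
  choose τ hτ using hsurj
  -- The quantile grid has mesh 1/n, which costs only the extra 1/n in the bound. The union bound
  -- over its n levels gives 2n exp(-2 n^{1-2β}), summable because β < 1/2, and Borel-Cantelli
  -- applies.
  let bad : ℕ → Set Ω := fun n => ⋃ k ∈ Finset.range n,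
    {ω | (n : ℝ) ^ (-β) < |empiricalCDF (fun i => X i ω) n (τ (k / n)) - F (τ (k / n))|}
  have hbad : ∀ n, P (bad n) ≤
      ENNReal.ofReal ((n : ℝ) * (2 * Real.exp (-2 * (n : ℝ) ^ (1 - 2 * β)))) := by
    intro n
    rcases Nat.eq_zero_or_pos n with rfl | hn
    · simp [bad]
    have hn' : (0 : ℝ) < n := by exact_mod_cast hn
    have hpow : (n : ℝ) * ((n : ℝ) ^ (-β)) ^ 2 = (n : ℝ) ^ (1 - 2 * β) := by
      rw [← Real.rpow_natCast, ← Real.rpow_mul hn'.le]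
      nth_rewrite 1 [← Real.rpow_one (n : ℝ)]
      rw [← Real.rpow_add hn']
      congr 1
      push_cast
      ring
    rw [← ofReal_measureReal (measure_ne_top P _)]
    refine ENNReal.ofReal_le_ofReal ((measureReal_biUnion_finset_le _ _).trans ?_)
    refine (Finset.sum_le_sum fun (k : ℕ) _ => measureReal_empiricalCDF_deviation_le hX hindep hF hn
      (τ (k / n)) (Real.rpow_nonneg hn'.le (-β))).trans ?_
    rw [hpow]
    simp
  have hsum : ∑' n, P (bad n) ≠ ∞ := by
    refine ne_top_of_le_ne_top ?_ (ENNReal.tsum_le_tsum hbad)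
    exact (summable_mul_exp_neg_rpow (by linarith)).tsum_ofReal_ne_top
  filter_upwards [ae_eventually_notMem hsum] with ω hω
  filter_upwards [hω, eventually_gt_atTop 0] with n hn hpos t
  have hn' : (0 : ℝ) < n := by exact_mod_cast hpos
  refine abs_sub_le_of_grid (τ := fun k => τ (k / n)) hmono (empiricalCDF_mono _ n) hF0 hF1
    (empiricalCDF_nonneg _ n) (empiricalCDF_le_one _ n) hpos (Real.rpow_nonneg hn'.le _)
    (fun k hk hkn => ?_) (fun k _ hkn => ?_) t
  · have hk' : (0 : ℝ) < k := by exact_mod_cast hk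
    have hkn' : (k : ℝ) < n := by exact_mod_cast hkn
    exact hτ _ (by positivity) (by rwa [div_lt_one hn'])
  · by_contra hcon
    refine hn (Set.mem_biUnion (Finset.mem_coe.mpr (Finset.mem_range.mpr hkn)) ?_)
    exact not_le.mp hcon

end Deviation

/-! ### The estimator as a smoothed empirical distribution function -/

theorem kernelCDFEstimator_eq_sum {K : ℝ → ℝ} (hK : Integrable K) (x : ℕ → ℝ) (n : ℕ) {h : ℝ}
    (hh : 0 < h) (t : ℝ) :
    kernelCDFEstimator K x n h t =
      (1 / (n : ℝ)) * ∑ i ∈ Finset.range n, ∫ u in Set.Iic ((t - x i) / h), K u := by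
  have hint : ∀ a, Integrable fun y => K ((y - a) / h) := fun a =>
    (hK.comp_div hh.ne').comp_sub_right a
  have hshift : ∀ a, ∫ y in Set.Iic t, K ((y - a) / h) =
      h * ∫ u in Set.Iic ((t - a) / h), K u := by
    intro a
    rw [← integral_indicator measurableSet_Iic, ← integral_indicator measurableSet_Iic]
    have h1 : ∀ y, (Set.Iic t).indicator (fun y => K ((y - a) / h)) y =
        (fun z => (Set.Iic ((t - a) / h)).indicator K (z / h)) (y - a) := by
      intro y
      simp only [Set.indicator, Set.mem_Iic, div_le_div_iff_of_pos_right hh, sub_le_sub_iff_right]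
    simp_rw [h1]
    rw [integral_sub_right_eq_self (fun z => (Set.Iic ((t - a) / h)).indicator K (z / h)) a,
      Measure.integral_comp_div, abs_of_pos hh, smul_eq_mul]
  unfold kernelCDFEstimator kernelDensityEstimator
  rw [integral_const_mul, integral_finsetSum _ fun i _ => (hint (x i)).integrableOn]
  simp_rw [hshift]
  rw [← Finset.mul_sum, ← mul_assoc]
  congr 1
  field_simp

theorem measurable_empiricalCDF (x : ℕ → ℝ) (n : ℕ) : Measurable (empiricalCDF x n) :=
  (empiricalCDF_mono x n).measurable

theorem abs_empiricalCDF_le_one (x : ℕ → ℝ) (n : ℕ) (t : ℝ) : |empiricalCDF x n t| ≤ 1 := by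
  rw [abs_of_nonneg (empiricalCDF_nonneg x n t)]
  exact empiricalCDF_le_one x n t

/-- Since x_i ≤ t - hu exactly when u ≤ (t - x_i)/h, both sides average the primitive of K at the
points (t - x_i)/h. Thereby F_n and F undergo the same linear operation. -/
theorem kernelCDFEstimator_eq_kernelSmooth {K : ℝ → ℝ} (hK : Integrable K) (x : ℕ → ℝ) (n : ℕ)
    {h : ℝ} (hh : 0 < h) :
    kernelCDFEstimator K x n h = kernelSmooth K h (empiricalCDF x n) := by
  funext t
  rw [kernelCDFEstimator_eq_sum hK x n hh]
  unfold kernelSmooth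
  have h1 : ∀ u, empiricalCDF x n (t - h * u) * K u =
      (1 / (n : ℝ)) * ∑ i ∈ Finset.range n, (Set.Iic ((t - x i) / h)).indicator K u := by
    intro u
    rw [empiricalCDF_eq_sum, mul_assoc, Finset.sum_mul]
    congr 1
    refine Finset.sum_congr rfl fun i _ => ?_
    simp only [Set.indicator, Set.mem_Iic, le_div_iff₀ hh, ite_mul, one_mul, zero_mul]
    congr 1
    rw [eq_iff_iff]
    constructor <;> intro h <;> linarith
  simp_rw [h1]
  rw [integral_const_mul, integral_finsetSum _ fun i _ => hK.indicator measurableSet_Iic]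
  simp_rw [integral_indicator measurableSet_Iic]

/-- Dilations act continuously, uniformly on the line, on a continuous function with limits at
infinity. -/
theorem eventually_abs_comp_div_sub_le {L : ℝ → ℝ} (hL : Continuous L) {a b : ℝ}
    (ha : Tendsto L atBot (𝓝 a)) (hb : Tendsto L atTop (𝓝 b)) {h₀ : ℝ} (hh₀ : 0 < h₀) {ε : ℝ}
    (hε : 0 < ε) : ∀ᶠ h in 𝓝 h₀, ∀ y, |L (y / h) - L (y / h₀)| ≤ ε := by
  obtain ⟨m, hm⟩ := eventually_atBot.mp (Metric.tendsto_nhds.mp ha (ε / 2) (half_pos hε))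
  obtain ⟨M, hM⟩ := eventually_atTop.mp (Metric.tendsto_nhds.mp hb (ε / 2) (half_pos hε))
  set R := max 1 (max (-m) M) with hR
  have hR1 : 1 ≤ R := le_max_left _ _
  have hRm : -R ≤ m := by
    have : -m ≤ R := (le_max_left _ _).trans (le_max_right _ _)
    linarith
  have hRM : M ≤ R := (le_max_right _ _).trans (le_max_right _ _)
  have hUC := (isCompact_Icc (a := -(4 * R)) (b := 4 * R)).uniformContinuousOn_of_continuous
    hL.continuousOn
  obtain ⟨δ, hδ, hUC⟩ := Metric.uniformContinuousOn_iff.mp hUC ε hε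
  have hratio : Tendsto (fun h : ℝ => h₀ / h) (𝓝 h₀) (𝓝 1) := by
    have : Tendsto (fun h : ℝ => h₀ / h) (𝓝 h₀) (𝓝 (h₀ / h₀)) :=
      tendsto_const_nhds.div tendsto_id hh₀.ne'
    rwa [div_self hh₀.ne'] at this
  -- The ratio r = h₀/h is within 1/2 of 1, so |z| ≥ 2R keeps both z and rz on the same side beyond
  -- R, where L is within ε/2 of its limit. For |z| ≤ 2R both points lie in [-4R, 4R] and, by the
  -- second bound, at distance less than δ.
  set ρ := min (1 / 2) (δ / (2 * R)) with hρ
  have hρpos : 0 < ρ := by positivity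
  filter_upwards [Metric.tendsto_nhds.mp hratio ρ hρpos, lt_mem_nhds hh₀] with h hr hpos y
  rw [Real.dist_eq] at hr
  have hr1 : |h₀ / h - 1| < 1 / 2 := hr.trans_le (min_le_left _ _)
  have hr2 : |h₀ / h - 1| < δ / (2 * R) := hr.trans_le (min_le_right _ _)
  set r := h₀ / h
  set z := y / h₀ with hz
  have hy : y / h = r * z := by
    simp only [r, z]
    field_simp
  rw [hy]
  rw [abs_lt] at hr1
  rcases le_total |z| (2 * R) with hzR | hzR
  · have hzR' := abs_le.mp hzR
    have hdist : dist (r * z) z < δ := by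
      rw [Real.dist_eq, show r * z - z = (r - 1) * z by ring, abs_mul]
      calc |r - 1| * |z| ≤ |r - 1| * (2 * R) := by gcongr
        _ < δ / (2 * R) * (2 * R) := by gcongr
        _ = δ := by field_simp
    have habs : |r * z| ≤ 4 * R := by
      rw [abs_mul, abs_of_pos (by linarith)]
      nlinarith [abs_nonneg z]
    have := hUC (r * z) (abs_le.mp habs) z ⟨by linarith, by linarith⟩ hdist
    exact this.le
  · rcases le_abs.mp hzR with hz' | hz'
    · have h1 := hM (r * z) (by nlinarith)
      have h2 := hM z (by linarith)
      have := dist_triangle_right (L (r * z)) (L z) b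
      rw [← Real.dist_eq]
      linarith
    · have h1 := hm (r * z) (by nlinarith)
      have h2 := hm z (by linarith)
      have := dist_triangle_right (L (r * z)) (L z) a
      rw [← Real.dist_eq]
      linarith

theorem eventually_abs_kernelCDFEstimator_sub_le {K : ℝ → ℝ} (hK : Integrable K) (x : ℕ → ℝ)
    (n : ℕ) {h₀ : ℝ} (hh₀ : 0 < h₀) {ε : ℝ} (hε : 0 < ε) :
    ∀ᶠ h in 𝓝 h₀, ∀ t, |kernelCDFEstimator K x n h t - kernelCDFEstimator K x n h₀ t| ≤ ε := by
  filter_upwards [eventually_abs_comp_div_sub_le (continuous_setIntegral_Iic hK)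
    (tendsto_setIntegral_Iic_atBot hK) (tendsto_setIntegral_Iic_atTop hK) hh₀ hε,
    lt_mem_nhds hh₀] with h hh hpos t
  rw [kernelCDFEstimator_eq_sum hK x n hpos, kernelCDFEstimator_eq_sum hK x n hh₀, ← mul_sub,
    ← Finset.sum_sub_distrib, abs_mul, abs_of_nonneg (by positivity)]
  calc (1 / (n : ℝ)) * |∑ i ∈ Finset.range n, ((∫ u in Set.Iic ((t - x i) / h), K u) -
        ∫ u in Set.Iic ((t - x i) / h₀), K u)|
      ≤ (1 / (n : ℝ)) * ∑ i ∈ Finset.range n, ε := by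
        gcongr
        exact (Finset.abs_sum_le_sum_abs _ _).trans (Finset.sum_le_sum fun i _ => hh (t - x i))
    _ = ((n : ℝ) / n) * ε := by simp; ring
    -- Only an inequality, because the quotient is 0 when n = 0.
    _ ≤ ε := mul_le_of_le_one_left hε.le (div_self_le_one _)

/-! ### Inverting a perturbed power law -/

section Inversion

variable {ℓ : ℕ} {Δ : ℝ → ℝ} {A : ℝ} {s : ℕ → ℝ} {D : ℕ → ℝ → ℝ} {E : ℕ → ℝ}

theorem tendsto_rpow_one_div_nhdsGT_zero (hℓ : 1 ≤ ℓ) (hA : 0 < A) (hs : ∀ᶠ n in atTop, 0 < s n)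
    (hs0 : Tendsto s atTop (𝓝 0)) :
    Tendsto (fun n => (s n / A) ^ (1 / (ℓ : ℝ))) atTop (𝓝[>] 0) := by
  have hp : 0 < 1 / (ℓ : ℝ) := by positivity
  refine tendsto_nhdsWithin_iff.mpr ⟨?_, hs.mono fun n hn => Real.rpow_pos_of_pos (by positivity) _⟩
  have h1 := (hs0.div_const A).rpow_const (p := 1 / (ℓ : ℝ)) (Or.inr hp.le)
  rwa [zero_div, Real.zero_rpow hp.ne'] at h1

theorem rpow_one_div_pow (hℓ : 1 ≤ ℓ) {a : ℝ} (ha : 0 ≤ a) : (a ^ (1 / (ℓ : ℝ))) ^ ℓ = a := by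
  rw [one_div]
  exact Real.rpow_inv_natCast_pow ha (by omega)

/-- At r times the predicted root, Δ equals r^ℓ s(n) (1 + o(1)), and the perturbation is o(s(n)). -/
theorem tendsto_perturbed_div (hℓ : 1 ≤ ℓ) (hA : 0 < A)
    (hlim : Tendsto (fun h => Δ h / h ^ ℓ) (𝓝[>] 0) (𝓝 A))
    (hs : ∀ᶠ n in atTop, 0 < s n) (hs0 : Tendsto s atTop (𝓝 0))
    (hE : Tendsto (fun n => E n / s n) atTop (𝓝 0))
    (hDE : ∀ᶠ n in atTop, ∀ h, 0 < h → |D n h - Δ h| ≤ E n) {r : ℝ} (hr : 0 < r) :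
    Tendsto (fun n => D n (r * (s n / A) ^ (1 / (ℓ : ℝ))) / s n) atTop (𝓝 (r ^ ℓ)) := by
  have hv := tendsto_rpow_one_div_nhdsGT_zero hℓ hA hs hs0
  set v : ℕ → ℝ := fun n => (s n / A) ^ (1 / (ℓ : ℝ)) with hvdef
  have hrv : Tendsto (fun n => r * v n) atTop (𝓝[>] 0) := by
    refine tendsto_nhdsWithin_iff.mpr ⟨?_, ?_⟩
    · simpa using (hv.mono_right nhdsWithin_le_nhds).const_mul r
    · exact (hv.eventually self_mem_nhdsWithin).mono fun n hn => mul_pos hr hn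
  have h1 : Tendsto (fun n => Δ (r * v n) / s n) atTop (𝓝 (r ^ ℓ)) := by
    have h2 := (hlim.comp hrv).mul_const (r ^ ℓ / A)
    rw [mul_div_cancel₀ _ hA.ne'] at h2
    refine h2.congr' ?_
    filter_upwards [hs] with n hn
    have : v n ^ ℓ = s n / A := rpow_one_div_pow hℓ (by positivity)
    simp only [Function.comp_apply]
    rw [mul_pow, this]
    field_simp
  have h3 : Tendsto (fun n => (D n (r * v n) - Δ (r * v n)) / s n) atTop (𝓝 0) := by
    refine squeeze_zero_norm' ?_ hE
    filter_upwards [hs, hDE, hrv.eventually self_mem_nhdsWithin] with n hn hd hpos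
    rw [norm_div, Real.norm_eq_abs, Real.norm_of_nonneg hn.le]
    exact div_le_div_of_nonneg_right (hd _ hpos) hn.le
  have h4 := h1.add h3
  rw [add_zero] at h4
  refine h4.congr fun n => ?_
  rw [← add_div, add_sub_cancel]

/-- Half and twice the predicted root bracket the threshold, since (1/2)^ℓ < 1 < 2^ℓ; continuity
does the rest. -/
theorem eventually_exists_eq_of_perturbed (hℓ : 1 ≤ ℓ) (hA : 0 < A)
    (hlim : Tendsto (fun h => Δ h / h ^ ℓ) (𝓝[>] 0) (𝓝 A))
    (hs : ∀ᶠ n in atTop, 0 < s n) (hs0 : Tendsto s atTop (𝓝 0))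
    (hE : Tendsto (fun n => E n / s n) atTop (𝓝 0))
    (hDE : ∀ᶠ n in atTop, ∀ h, 0 < h → |D n h - Δ h| ≤ E n)
    (hDc : ∀ n, ContinuousOn (D n) (Set.Ioi 0)) :
    ∀ᶠ n in atTop, ∃ h, 0 < h ∧ D n h = s n := by
  have h1 := tendsto_perturbed_div hℓ hA hlim hs hs0 hE hDE (r := 1 / 2) (by norm_num)
  have h2 := tendsto_perturbed_div hℓ hA hlim hs hs0 hE hDE (r := 2) (by norm_num)
  have hv := tendsto_rpow_one_div_nhdsGT_zero hℓ hA hs hs0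
  filter_upwards [hs, hv.eventually self_mem_nhdsWithin,
    h1.eventually_lt_const (pow_lt_one₀ (by norm_num) (by norm_num) (by omega)),
    h2.eventually_const_lt (one_lt_pow₀ (by norm_num) (by omega))] with n hn hvn hlo hhi
  set v := (s n / A) ^ (1 / (ℓ : ℝ))
  change 0 < v at hvn
  rw [div_lt_one hn] at hlo
  rw [one_lt_div hn] at hhi
  obtain ⟨h, hh, heq⟩ := intermediate_value_Icc (by linarith : 1 / 2 * v ≤ 2 * v)
    ((hDc n).mono fun x hx => lt_of_lt_of_le (by positivity : 0 < 1 / 2 * v) hx.1)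
    ⟨hlo.le, hhi.le⟩
  exact ⟨h, lt_of_lt_of_le (by positivity) hh.1, heq⟩

/-- Along any solutions Δ(h n) ~ s n → 0, and the lower bound `hbelow` forces h n → 0. Only then can
the asymptotics of Δ at 0 be used and an ℓ-th root taken. -/
theorem isEquivalent_of_perturbed (hℓ : 1 ≤ ℓ) (hA : 0 < A)
    (hlim : Tendsto (fun h => Δ h / h ^ ℓ) (𝓝[>] 0) (𝓝 A))
    (hbelow : ∀ ε > 0, ∃ δ > 0, ∀ h, ε ≤ h → δ ≤ Δ h)
    (hs : ∀ᶠ n in atTop, 0 < s n) (hs0 : Tendsto s atTop (𝓝 0))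
    (hE : Tendsto (fun n => E n / s n) atTop (𝓝 0))
    (hDE : ∀ᶠ n in atTop, ∀ h, 0 < h → |D n h - Δ h| ≤ E n)
    {h : ℕ → ℝ} (hh : ∀ᶠ n in atTop, 0 < h n ∧ D n (h n) = s n) :
    IsEquivalent atTop h fun n => (s n / A) ^ (1 / (ℓ : ℝ)) := by
  have hv := tendsto_rpow_one_div_nhdsGT_zero hℓ hA hs hs0
  have hΔs : Tendsto (fun n => Δ (h n) / s n) atTop (𝓝 1) := by
    refine tendsto_iff_norm_sub_tendsto_zero.mpr (squeeze_zero' (Eventually.of_forall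
      fun _ => norm_nonneg _) ?_ hE)
    filter_upwards [hs, hDE, hh] with n hn hd hhn
    have h1 := hd _ hhn.1
    rw [hhn.2, abs_sub_comm] at h1
    rw [div_sub_one hn.ne', norm_div, Real.norm_eq_abs, Real.norm_of_nonneg hn.le]
    exact div_le_div_of_nonneg_right h1 hn.le
  have hΔ0 : Tendsto (fun n => Δ (h n)) atTop (𝓝 0) := by
    have h1 := hΔs.mul hs0
    rw [mul_zero] at h1
    refine h1.congr' ?_
    filter_upwards [hs] with n hn
    rw [div_mul_cancel₀ _ hn.ne']
  have hh0 : Tendsto h atTop (𝓝[>] 0) := by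
    refine tendsto_nhdsWithin_iff.mpr ⟨?_, hh.mono fun n hn => hn.1⟩
    rw [Metric.tendsto_nhds]
    intro ε hε
    obtain ⟨δ, hδ, hb⟩ := hbelow ε hε
    filter_upwards [hh, hΔ0.eventually_lt_const hδ] with n hn hlt
    rw [Real.dist_eq, sub_zero, abs_of_pos hn.1]
    by_contra hcon
    exact absurd (hb _ (not_lt.mp hcon)) (not_le.mpr hlt)
  -- The quotient of Δ/s by Δ/h^ℓ, times A, is A h^ℓ / s.
  have hpow : Tendsto (fun n => (h n / (s n / A) ^ (1 / (ℓ : ℝ))) ^ ℓ) atTop (𝓝 1) := by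
    have h1 := (hΔs.div (hlim.comp hh0) hA.ne').mul_const A
    rw [one_div_mul_cancel hA.ne'] at h1
    refine h1.congr' ?_
    filter_upwards [hs, hh, hΔs.eventually_ne one_ne_zero] with n hn hhn hne
    have hΔne : Δ (h n) ≠ 0 := fun h0 => hne (by rw [h0, zero_div])
    have hhne := hhn.1.ne'
    simp only [Function.comp_apply, Pi.div_apply]
    rw [div_pow, rpow_one_div_pow hℓ (by positivity)]
    field_simp
  have hroot := hpow.rpow_const (p := 1 / (ℓ : ℝ)) (Or.inl one_ne_zero)
  rw [Real.one_rpow] at hroot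
  rw [isEquivalent_iff_tendsto_one ((hv.eventually self_mem_nhdsWithin).mono
    fun n (hn : 0 < _) => hn.ne')]
  refine hroot.congr' ?_
  filter_upwards [hh, hv.eventually self_mem_nhdsWithin] with n hhn hvn
  change 0 < (s n / A) ^ (1 / (ℓ : ℝ)) at hvn
  rw [Pi.div_apply, one_div (ℓ : ℝ)]
  rw [one_div] at hvn
  exact Real.pow_rpow_inv_natCast (div_nonneg hhn.1.le hvn.le) (by omega)

end Inversion

/-! ### The discrepancy as a function of the bandwidth -/

theorem exists_abs_le_and_uniformContinuous {g : ℝ → ℝ} (hg : Continuous g)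
    (hbot : Tendsto g atBot (𝓝 0)) (htop : Tendsto g atTop (𝓝 0)) :
    (∃ M, ∀ x, |g x| ≤ M) ∧ UniformContinuous g := by
  have hz : Tendsto g (cocompact ℝ) (𝓝 0) := by
    rw [cocompact_eq_atBot_atTop]
    exact hbot.sup htop
  let G : ZeroAtInftyContinuousMap ℝ ℝ := ⟨⟨g, hg⟩, hz⟩
  exact ⟨⟨‖G.toBCF‖, fun x => G.toBCF.norm_coe_le_norm x⟩, ZeroAtInftyContinuousMap.uniformContinuous G⟩

section Distance

variable {d : (ℝ → ℝ) → (ℝ → ℝ) → ℝ≥0∞} {C : ℝ} {K F : ℝ → ℝ} {B : ℝ}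

theorem abs_sub_kernelSmooth_le (hK : Integrable K) (hB : ∀ x, |F x| ≤ B) (h x : ℝ) :
    |(F - kernelSmooth K h F) x| ≤ B * (1 + ∫ u, |K u|) := by
  have h1 := abs_kernelSmooth_le hK hB h x
  have h2 := abs_sub (F x) (kernelSmooth K h F x)
  rw [Pi.sub_apply]
  linarith [hB x]

/-- Replacing `F` by a uniformly close function changes the discrepancy between `F` and its
smoothed version by a comparable amount. -/
theorem IsUniformTypeDist.abs_discrepancy_sub_le (hd : IsUniformTypeDist d C) (hK : Integrable K)
    (hF : Measurable F) (hB : ∀ x, |F x| ≤ B) {G : ℝ → ℝ} (hG : Measurable G) {B' : ℝ}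
    (hB' : ∀ x, |G x| ≤ B') {e : ℝ} (he : ∀ x, |G x - F x| ≤ e) (h : ℝ) :
    |(d G (kernelSmooth K h G)).toReal - (d F (kernelSmooth K h F)).toReal| ≤
      C * (e * (1 + ∫ u, |K u|)) := by
  rw [hd.eq_sub, hd.eq_sub F]
  refine hd.abs_toReal_sub_le (abs_sub_kernelSmooth_le hK hB' h) fun x => ?_
  have h1 := abs_sub_kernelSmooth_le hK (F := G - F) he h x
  rw [Pi.sub_apply, kernelSmooth_sub hK hG hF hB' hB h x, Pi.sub_apply] at h1
  rw [Pi.sub_apply, Pi.sub_apply]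
  convert h1 using 2
  ring

/-- The difference F - K_h * F vanishes at -∞, as required for the seminorm to dominate pointwise
values. This transfers the pointwise lower bound on the bias to d. -/
theorem IsUniformTypeDist.le_discrepancy (hd : IsUniformTypeDist d C) (hK : Integrable K)
    (hF : Measurable F) (hB : ∀ x, |F x| ≤ B) (hbot : Tendsto F atBot (𝓝 0)) (h x : ℝ) :
    |F x - kernelSmooth K h F x| ≤ (d F (kernelSmooth K h F)).toReal := by
  have hlim : Tendsto (F - kernelSmooth K h F) atBot (𝓝 0) := by
    have h1 : Tendsto (fun x => kernelSmooth K h F x) atBot (𝓝 (∫ u, (0 : ℝ) * K u)) :=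
      tendsto_kernelSmooth (G := fun _ => 0) hK hF hB (h := fun _ => h) (x := id)
        (Eventually.of_forall fun u => hbot.comp
          (tendsto_atBot_add_const_right atBot (-(h * u)) tendsto_id))
    have h2 := hbot.sub h1
    simp only [zero_mul, integral_zero, sub_zero] at h2
    exact h2
  have h1 := hd.le_of_tendsto _ hlim x
  rw [← hd.eq_sub] at h1
  have hfin : d F (kernelSmooth K h F) ≠ ∞ := by
    rw [hd.eq_sub]
    exact (hd.lt_top (abs_sub_kernelSmooth_le hK hB h)).ne
  exact (ENNReal.ofReal_le_iff_le_toReal hfin).mp h1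

/-- The bias expansion holds in supremum norm, so it passes through the seminorm; homogeneity leaves
only the absolute value of the coefficient, and the signs disappear. -/
theorem IsUniformTypeDist.tendsto_discrepancy_div (hd : IsUniformTypeDist d C) {ℓ : ℕ}
    (hK : IsKernelOfOrder ℓ K) {H : ℕ → ℝ → ℝ}
    (hH : ∀ j < ℓ, ∀ x, HasDerivAt (H j) (H (j + 1) x) x) (hcont : UniformContinuous (H ℓ))
    {M : ℝ} (hM : ∀ x, |H ℓ x| ≤ M) (hB : ∀ x, |H 0 x| ≤ B) :
    Tendsto (fun h => (d (H 0) (kernelSmooth K h (H 0))).toReal / h ^ ℓ) (𝓝[>] 0)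
      (𝓝 (|kernelMoment K ℓ| / ℓ.factorial * (d (H ℓ) 0).toReal)) := by
  have hK0 : Integrable K := by simpa using hK.integrable 0 (Nat.zero_le _)
  rw [Metric.tendsto_nhds]
  intro ε hε
  have hC := hd.nonneg
  filter_upwards [kernelSmooth_bias hK hH hcont hM hB (ε := ε / (2 * (C + 1))) (by positivity),
    self_mem_nhdsWithin] with h hbias hpos
  simp only [Set.mem_Ioi] at hpos
  have hpow : 0 < h ^ ℓ := pow_pos hpos ℓ
  have h1 := hd.abs_toReal_sub_le (abs_sub_kernelSmooth_le hK0 hB h)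
    (v := (-((-1) ^ ℓ * kernelMoment K ℓ / (ℓ.factorial : ℝ)) * h ^ ℓ) • H ℓ) hbias
  rw [← hd.eq_sub, hd.smul, ENNReal.toReal_mul, ENNReal.toReal_ofReal (abs_nonneg _), abs_mul,
    abs_neg, abs_div, abs_mul, abs_pow, abs_neg, abs_one, one_pow, one_mul, Nat.abs_cast,
    abs_of_pos hpow] at h1
  rw [Real.dist_eq]
  have h2 : (d (H 0) (kernelSmooth K h (H 0))).toReal / h ^ ℓ -
      |kernelMoment K ℓ| / ℓ.factorial * (d (H ℓ) 0).toReal =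
      ((d (H 0) (kernelSmooth K h (H 0))).toReal -
        |kernelMoment K ℓ| / ℓ.factorial * h ^ ℓ * (d (H ℓ) 0).toReal) / h ^ ℓ := by
    field_simp
  rw [h2, abs_div, abs_of_pos hpow, div_lt_iff₀ hpow]
  refine h1.trans_lt ?_
  rw [← mul_assoc]
  refine mul_lt_mul_of_pos_right ?_ hpow
  rw [mul_div_assoc', div_lt_iff₀ (by positivity)]
  nlinarith

theorem IsUniformTypeDist.continuousOn_discrepancy (hd : IsUniformTypeDist d C)
    (hK : Integrable K) (x : ℕ → ℝ) (n : ℕ) :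
    ContinuousOn (fun h => (d (empiricalCDF x n) (kernelCDFEstimator K x n h)).toReal)
      (Set.Ioi 0) := by
  intro h₀ hh₀
  refine ContinuousAt.continuousWithinAt (Metric.tendsto_nhds.mpr fun ε hε => ?_)
  have hC := hd.nonneg
  filter_upwards [eventually_abs_kernelCDFEstimator_sub_le hK x n hh₀
    (ε := ε / (2 * (C + 1))) (by positivity), lt_mem_nhds hh₀] with h hh hpos
  rw [Real.dist_eq, hd.eq_sub, hd.eq_sub _ (kernelCDFEstimator K x n h₀)]
  have h1 := hd.abs_toReal_sub_le (u := empiricalCDF x n - kernelCDFEstimator K x n h)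
    (v := empiricalCDF x n - kernelCDFEstimator K x n h₀) (A := 1 * (1 + ∫ u, |K u|))
    (B := ε / (2 * (C + 1))) (by
      rw [kernelCDFEstimator_eq_kernelSmooth hK x n hpos]
      exact abs_sub_kernelSmooth_le hK (abs_empiricalCDF_le_one x n) h) fun t => by
        rw [Pi.sub_apply, Pi.sub_apply, sub_sub_sub_cancel_left, abs_sub_comm]
        exact hh t
  refine h1.trans_lt ?_
  rw [mul_div_assoc', div_lt_iff₀ (by positivity)]
  nlinarith

end Distance

/-! ### The main theorem -/

theorem mainTheorem1
    {Ω : Type*} [MeasurableSpace Ω] (P : Measure Ω) [IsProbabilityMeasure P]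
    (X : ℕ → Ω → ℝ) (hX : ∀ i, Measurable (X i)) (hindep : iIndepFun X P)
    (f : ℝ → ℝ) (hf_nonneg : 0 ≤ᵐ[volume] f)
    (hlaw : ∀ i, P.map (X i) = volume.withDensity (fun x => ENNReal.ofReal (f x)))
    (ℓ : ℕ) (hf : MemSobolevL1 ℓ f)
    (K : ℝ → ℝ) (hK : IsKernelOfOrder ℓ K)
    (d : (ℝ → ℝ) → (ℝ → ℝ) → ℝ≥0∞)
    (hd : d = kolmogorovDist ∨ ∃ k : ℕ, 1 ≤ k ∧ d = kuiperDist k)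
    (c γ : ℝ) (hc : 0 < c) (hγ_pos : 0 < γ) (hγ_lt : γ < 1 / 2) :
    ∃ g : ℝ → ℝ, Continuous g ∧ IsWeakDeriv (ℓ - 1) f g ∧
      0 < d g 0 ∧ d g 0 < ∞ ∧
      ∀ᵐ ω ∂P,
        (∀ᶠ n : ℕ in atTop, ∃ h : ℝ,
          IsDiscrepancyBandwidth d K (c * (n : ℝ) ^ (-γ)) (fun i => X i ω) n h) ∧
        ∀ h : ℕ → ℝ,
          (∀ᶠ n : ℕ in atTop,
            IsDiscrepancyBandwidth d K (c * (n : ℝ) ^ (-γ)) (fun i => X i ω) n (h n)) →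
          IsEquivalent atTop h (fun n : ℕ =>
            (c * (ℓ.factorial : ℝ) / (|kernelMoment K ℓ| * (d g 0).toReal)) ^ (1 / (ℓ : ℝ)) *
              (n : ℝ) ^ (-γ / (ℓ : ℝ))) := by
  have hℓ := hK.one_le
  have hK0 : Integrable K := by simpa using hK.integrable 0 (Nat.zero_le _)
  obtain ⟨C, hd⟩ : ∃ C, IsUniformTypeDist d C := by
    rcases hd with rfl | ⟨k, hk, rfl⟩
    · exact ⟨_, isUniformTypeDist_kolmogorovDist⟩
    · exact ⟨_, isUniformTypeDist_kuiperDist hk⟩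
  obtain ⟨H, hH0, hHd, hHc, hHp, hf1, hweak⟩ := hf.exists_chain hℓ
  obtain ⟨hgc, -, hgbot, hgtop⟩ := hHc ℓ hℓ le_rfl
  obtain ⟨hqc, hqi, hqbot, hqtop⟩ := hHc 1 le_rfl hℓ
  obtain ⟨⟨M, hM⟩, hguc⟩ := exists_abs_le_and_uniformContinuous hgc hgbot hgtop
  obtain ⟨⟨M', hM'⟩, -⟩ := exists_abs_le_and_uniformContinuous hqc hqbot hqtop
  have hcdf : ∀ i t, P.real {ω | X i ω ≤ t} = H 0 t := by
    intro i t
    have h1 : P {ω | X i ω ≤ t} = P.map (X i) (Set.Iic t) := by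
      rw [Measure.map_apply (hX i) measurableSet_Iic]
      rfl
    rw [measureReal_def, h1, hlaw i, withDensity_apply _ measurableSet_Iic, hH0,
      ← ofReal_integral_eq_lintegral_ofReal hf.1.integrableOn (ae_restrict_of_ae hf_nonneg),
      ENNReal.toReal_ofReal (integral_nonneg_of_ae (ae_restrict_of_ae hf_nonneg))]
  have hfI : ∫ x, f x = 1 := by
    have h1 : P.map (X 0) Set.univ = 1 := by
      rw [Measure.map_apply (hX 0) MeasurableSet.univ, Set.preimage_univ, measure_univ]
    rw [hlaw 0, withDensity_apply _ MeasurableSet.univ, Measure.restrict_univ,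
      ← ofReal_integral_eq_lintegral_ofReal hf.1 hf_nonneg] at h1
    exact ENNReal.ofReal_eq_one.mp h1
  have hqI : ∫ x, H 1 x = 1 := by rw [← integral_congr_ae hf1, hfI]
  have hFbot : Tendsto (H 0) atBot (𝓝 0) := by
    rw [hH0]
    exact tendsto_setIntegral_Iic_atBot hf.1
  have hFtop : Tendsto (H 0) atTop (𝓝 1) := by
    rw [hH0, ← hfI]
    exact tendsto_setIntegral_Iic_atTop hf.1
  have hFc : Continuous (H 0) := by
    rw [hH0]
    exact continuous_setIntegral_Iic hf.1
  have hFB : ∀ x, |H 0 x| ≤ 1 := fun x => by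
    rw [← hcdf 0 x, abs_of_nonneg measureReal_nonneg]
    exact measureReal_le_one
  have hfin : d (H ℓ) 0 < ∞ := hd.lt_top hM
  -- If the seminorm vanished, so would `H ℓ`, and integrating downwards also the density `H 1`,
  -- whose integral is 1.
  have hpos : 0 < d (H ℓ) 0 := by
    rw [pos_iff_ne_zero]
    intro hzero
    have hg0 : H ℓ = 0 := by
      funext x
      have := hd.le_of_tendsto _ hgbot x
      rw [hzero, nonpos_iff_eq_zero, ENNReal.ofReal_eq_zero] at this
      exact abs_nonpos_iff.mp this
    have hall : ∀ i < ℓ, H (ℓ - i) = 0 := by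
      intro i
      induction i with
      | zero => exact fun _ => hg0
      | succ i ih =>
        intro hi
        have h1 := hHp (ℓ - i) (by omega) (by omega)
        rw [ih (by omega)] at h1
        rw [show ℓ - (i + 1) = ℓ - i - 1 by omega, h1]
        funext x
        simp
    have h1 := hall (ℓ - 1) (by omega)
    rw [show ℓ - (ℓ - 1) = 1 by omega] at h1
    rw [h1] at hqI
    simp at hqI
  have hgpos : 0 < (d (H ℓ) 0).toReal := ENNReal.toReal_pos hpos.ne' hfin.ne
  have hkpos : 0 < |kernelMoment K ℓ| := abs_pos.mpr hK.moment_top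
  refine ⟨H ℓ, hgc, hweak, hpos, hfin, ?_⟩
  set A := |kernelMoment K ℓ| / ℓ.factorial * (d (H ℓ) 0).toReal with hA
  have hApos : 0 < A := by positivity
  set s : ℕ → ℝ := fun n => c * (n : ℝ) ^ (-γ) with hsdef
  have hs : ∀ᶠ n in atTop, 0 < s n := by
    filter_upwards [eventually_gt_atTop 0] with n hn
    have : (0 : ℝ) < n := by exact_mod_cast hn
    positivity
  have hs0 : Tendsto s atTop (𝓝 0) := by
    have := ((tendsto_rpow_neg_atTop hγ_pos).comp tendsto_natCast_atTop_atTop).const_mul c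
    simpa using this
  -- Any rate strictly between γ and 1/2 is attained by F_n yet negligible against s(n).
  obtain ⟨β, hγβ, hβ⟩ := exists_between hγ_lt
  set E : ℕ → ℝ := fun n => C * (((n : ℝ) ^ (-β) + 1 / n) * (1 + ∫ u, |K u|)) with hEdef
  have hE : Tendsto (fun n => E n / s n) atTop (𝓝 0) := by
    have h1 : Tendsto (fun n : ℕ => (n : ℝ) ^ (-(β - γ))) atTop (𝓝 0) :=
      (tendsto_rpow_neg_atTop (by linarith)).comp tendsto_natCast_atTop_atTop
    have h2 : Tendsto (fun n : ℕ => (n : ℝ) ^ (-(1 - γ))) atTop (𝓝 0) :=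
      (tendsto_rpow_neg_atTop (by linarith)).comp tendsto_natCast_atTop_atTop
    have h3 := (h1.add h2).const_mul (C * (1 + ∫ u, |K u|) / c)
    rw [add_zero, mul_zero] at h3
    refine h3.congr' ?_
    filter_upwards [eventually_gt_atTop 0] with n hn
    have hn' : (0 : ℝ) < n := by exact_mod_cast hn
    have e1 : (n : ℝ) ^ (-β) = (n : ℝ) ^ (-(β - γ)) * (n : ℝ) ^ (-γ) := by
      rw [← Real.rpow_add hn']
      congr 1
      ring
    have e2 : 1 / (n : ℝ) = (n : ℝ) ^ (-(1 - γ)) * (n : ℝ) ^ (-γ) := by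
      rw [← Real.rpow_add hn', one_div, ← Real.rpow_neg_one]
      congr 1
      ring
    have hne : (n : ℝ) ^ (-γ) ≠ 0 := (Real.rpow_pos_of_pos hn' _).ne'
    simp only [hEdef, hsdef]
    rw [e1, e2]
    field_simp
  have hlim := hd.tendsto_discrepancy_div hK hHd hguc hM hFB
  have hbelow : ∀ ε > 0, ∃ δ > 0, ∀ h, ε ≤ h →
      δ ≤ (d (H 0) (kernelSmooth K h (H 0))).toReal := by
    intro ε hε
    obtain ⟨δ, hδ, hb⟩ := exists_le_abs_sub_kernelSmooth hK (fun x => hHd 0 hℓ x) hqi hqc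
      (by rw [hqI]; exact one_ne_zero) hM' hFB zero_ne_one hFbot hFtop hε
    refine ⟨δ, hδ, fun h hh => ?_⟩
    obtain ⟨x, hx⟩ := hb h hh
    exact hx.trans (hd.le_discrepancy hK0 hFc.measurable hFB hFbot h x)
  filter_upwards [ae_eventually_abs_empiricalCDF_sub_le hX hindep hcdf hFc hFbot hFtop hβ]
    with ω hω
  let D : ℕ → ℝ → ℝ := fun n h => (d (empiricalCDF (fun i => X i ω) n)
    (kernelCDFEstimator K (fun i => X i ω) n h)).toReal
  have hDE : ∀ᶠ n in atTop, ∀ h, 0 < h →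
      |D n h - (d (H 0) (kernelSmooth K h (H 0))).toReal| ≤ E n := by
    filter_upwards [hω] with n hn h hh
    simp only [D]
    rw [kernelCDFEstimator_eq_kernelSmooth hK0 _ n hh]
    exact hd.abs_discrepancy_sub_le hK0 hFc.measurable hFB (measurable_empiricalCDF _ n)
      (abs_empiricalCDF_le_one _ n) hn h
  -- The discrepancy is finite and the threshold is eventually positive, so the equation in [0, ∞]
  -- is one between reals.
  have hsol : ∀ᶠ n in atTop, ∀ h, IsDiscrepancyBandwidth d K (s n) (fun i => X i ω) n h ↔
      0 < h ∧ D n h = s n := by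
    filter_upwards [hs] with n hn h
    refine and_congr_right fun hh => ?_
    have hfin : d (empiricalCDF (fun i => X i ω) n)
        (kernelCDFEstimator K (fun i => X i ω) n h) ≠ ∞ := by
      rw [hd.eq_sub, kernelCDFEstimator_eq_kernelSmooth hK0 _ n hh]
      exact (hd.lt_top (abs_sub_kernelSmooth_le hK0 (abs_empiricalCDF_le_one _ n) h)).ne
    constructor
    · intro h1
      simp only [D]
      rw [h1, ENNReal.toReal_ofReal hn.le]
    · intro h1
      rw [← h1, ENNReal.ofReal_toReal hfin]
  constructor
  · filter_upwards [hsol, eventually_exists_eq_of_perturbed hℓ hApos hlim hs hs0 hE hDE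
      fun n => hd.continuousOn_discrepancy hK0 _ n] with n hn hex
    obtain ⟨h, hh⟩ := hex
    exact ⟨h, (hn h).mpr hh⟩
  · intro h hh
    have h1 : ∀ᶠ n in atTop, 0 < h n ∧ D n (h n) = s n := by
      filter_upwards [hsol, hh] with n hn hhn
      exact (hn (h n)).mp hhn
    refine (isEquivalent_of_perturbed hℓ hApos hlim hbelow hs hs0 hE hDE h1).congr_right ?_
    filter_upwards [eventually_gt_atTop 0] with n hn
    have hn' : (0 : ℝ) < n := by exact_mod_cast hn
    have e1 : s n / A = c * (ℓ.factorial : ℝ) / (|kernelMoment K ℓ| * (d (H ℓ) 0).toReal) *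
        (n : ℝ) ^ (-γ) := by
      simp only [hsdef, hA]
      field_simp
    rw [e1, Real.mul_rpow (by positivity) (by positivity), ← Real.rpow_mul hn'.le, mul_one_div]
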